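/- All graphs are finite, simple and undirected. The Minimum Cover Spanning Tree problem (MCST) asks, for a connected graph $G$ and a positive integer $k$, whether $G$ has a spanning tree $T$ that has a vertex cover of size at most $k$. A $w$-expression tree is a rooted tree whose leaves are introduce nodes (create a single vertex with a label $i\in[w]$) and whose inner nodes are union nodes (disjoint union of two $w$-labeled graphs), relabel nodes $\rho_{i\to j}$ (replace every label $i$ by $j$) and join nodes $\eta_{i,j}$ (add all possible edges between vertices labeled $i$ and vertices labeled $j$). It is a $w$-expression tree of $G$ if the graph constructed at its root is isomorphic to $G$. The tree is given by $w$, its number of nodes, and the list of its nodes in post-order. Theorem. There are a single random access machine program and a constant $c$ such that for every $w\ge 1$, every connected graph $G$ on $n$ vertices, every $w$-expression tree of $G$ and every integer $k\ge 1$, the program, on input the tree and $k$, decides whether $(G,k)$ is a yes-instance of MCST in at most $2^{2^{cw}}\cdot N$ steps, where $N$ is the number of nodes of the tree. In particular, whenever $N\le a\,n$ for a natural number $a$, the number of steps is at most $a\cdot 2^{2^{cw}}\cdot n$; thus MCST is solved in time $2^{2^{O(w)}}n$ on $w$-expression trees with $O(n)$ nodes. Here every operation on words takes one step, and all words and addresses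 that occur are at most $2^{2^{cw}}(N+k)$. -/

import Mathlib

/-! ## Minimum cover spanning trees -/

/-- `(G, k)` is a yes-instance of Minimum Cover Spanning Tree: `G` has a spanning tree that has
a vertex cover of size at most `k`. -/
def MinCoverSpanningTree {V : Type} (G : SimpleGraph V) (k : ℕ) : Prop :=
  ∃ T : SimpleGraph V, T ≤ G ∧ T.IsTree ∧
    ∃ C : Finset V, T.IsVertexCover (C : Set V) ∧ C.card ≤ k

/-! ## Expression trees over `w` labels -/

/-- Expression trees for clique-width with label set `Fin w`. -/
inductive CWExpr (w : ℕ) : Type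
  /-- a single vertex with label `i` -/
  | intro (i : Fin w) : CWExpr w
  /-- disjoint union -/
  | union (s t : CWExpr w) : CWExpr w
  /-- replace every label `i` by `j` -/
  | relabel (i j : Fin w) (t : CWExpr w) : CWExpr w
  /-- add all possible edges between vertices labeled `i` and vertices labeled `j` -/
  | join (i j : Fin w) (t : CWExpr w) : CWExpr w

namespace CWExpr

variable {w : ℕ}

/-- The vertices of the constructed graph: the introduce nodes of the tree. -/
def Vert : CWExpr w → Type
  | intro _ => Unit
  | union s t => s.Vert ⊕ t.Vert
  | relabel _ _ t => t.Vert
  | join _ _ t => t.Vert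

/-- The labels of the vertices of the constructed graph. -/
def label : (T : CWExpr w) → T.Vert → Fin w
  | intro i, _ => i
  | union s _, Sum.inl x => s.label x
  | union _ t, Sum.inr x => t.label x
  | relabel i j t, x => if t.label x = i then j else t.label x
  | join _ _ t, x => t.label x

/-- The graph that is constructed by an expression tree. -/
def graph : (T : CWExpr w) → SimpleGraph T.Vert
  | intro _ => (⊥ : SimpleGraph Unit)
  | union s t => SimpleGraph.sum s.graph t.graph
  | relabel _ _ t => t.graph
  | join i j t => t.graph ⊔ SimpleGraph.fromRel fun x y => t.label x = i ∧ t.label y = j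

/-- `T` is an expression tree of the graph `G`: it constructs a graph isomorphic to `G`. -/
def IsExprOf {V : Type} (T : CWExpr w) (G : SimpleGraph V) : Prop :=
  Nonempty (T.graph ≃g G)

/-- The number of nodes of the tree. -/
def numNodes : CWExpr w → ℕ
  | intro _ => 1
  | union s t => s.numNodes + t.numNodes + 1
  | relabel _ _ t => t.numNodes + 1
  | join _ _ t => t.numNodes + 1

/-- The list of the nodes in post-order; each node takes three words, its kind and its two
labels (`0` where there is none). -/
def code : CWExpr w → List ℕ
  | intro i => [0, (i : ℕ), 0]
  | union s t => s.code ++ t.code ++ [1, 0, 0]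
  | relabel i j t => t.code ++ [2, (i : ℕ), (j : ℕ)]
  | join i j t => t.code ++ [3, (i : ℕ), (j : ℕ)]

end CWExpr

/-! ## Random access machine

Programs of a word RAM in structured form: finitely many registers and arrays (those that occur
in the program), natural numbers as words, constant-time arithmetic on words, and indirect
addressing. Every operation, literal, access and branching costs one step. -/

namespace RAM

/-- The operations on words. Subtraction is truncated, division rounds down (and `x / 0 = 0`,
`x % 0 = x`), and comparisons return `0` or `1`. -/
inductive Op : Type
  | add | sub | mul | div | mod | and | or | lt | eq

/-- The value of an operation. -/
def Op.eval : Op → ℕ → ℕ → ℕ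
  | .add, x, y => x + y
  | .sub, x, y => x - y
  | .mul, x, y => x * y
  | .div, x, y => x / y
  | .mod, x, y => x % y
  | .and, x, y => x &&& y
  | .or, x, y => x ||| y
  | .lt, x, y => if x < y then 1 else 0
  | .eq, x, y => if x = y then 1 else 0

/-- The contents of the registers and of the cells of the arrays. -/
structure State : Type where
  reg : ℕ → ℕ
  arr : ℕ → ℕ → ℕ

/-- Write `v` into register `x`. -/
def State.setReg (σ : State) (x v : ℕ) : State :=
  { σ with reg := Function.update σ.reg x v }

/-- Write `v` into cell `i` of array `a`. -/
def State.setArr (σ : State) (a i v : ℕ) : State :=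
  { σ with arr := Function.update σ.arr a (Function.update (σ.arr a) i v) }

/-- Expressions: a literal, a register, a cell of an array, or an operation. -/
inductive Expr : Type
  | lit (c : ℕ) : Expr
  | reg (x : ℕ) : Expr
  | get (a : ℕ) (i : Expr) : Expr
  | op (o : Op) (e₁ e₂ : Expr) : Expr

/-- The value of an expression in a state. -/
def Expr.eval (σ : State) : Expr → ℕ
  | .lit c => c
  | .reg x => σ.reg x
  | .get a i => σ.arr a (i.eval σ)
  | .op o e₁ e₂ => o.eval (e₁.eval σ) (e₂.eval σ)

/-- All values that occur in the evaluation of an expression are at most `W`. -/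
def Expr.Fits (W : ℕ) (σ : State) : Expr → Prop
  | .lit c => c ≤ W
  | .reg x => σ.reg x ≤ W
  | .get a i => i.Fits W σ ∧ σ.arr a (i.eval σ) ≤ W
  | .op o e₁ e₂ => e₁.Fits W σ ∧ e₂.Fits W σ ∧ o.eval (e₁.eval σ) (e₂.eval σ) ≤ W

/-- The number of steps that the evaluation of an expression takes. -/
def Expr.cost : Expr → ℕ
  | .lit _ => 1
  | .reg _ => 1
  | .get _ i => i.cost + 1
  | .op _ e₁ e₂ => e₁.cost + e₂.cost + 1

/-- Programs. A test `e` succeeds if the value of `e` is not `0`. -/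
inductive Program : Type
  | skip : Program
  | assign (x : ℕ) (e : Expr) : Program
  | store (a : ℕ) (i e : Expr) : Program
  | seq (p q : Program) : Program
  | ite (e : Expr) (p q : Program) : Program
  | loop (e : Expr) (p : Program) : Program

/-- `Exec W p σ t τ`: the program `p`, started in the state `σ`, halts in the state `τ` after
exactly `t` steps, and all words and addresses that it uses are at most `W`. -/
inductive Exec (W : ℕ) : Program → State → ℕ → State → Prop
  | skip (σ : State) : Exec W .skip σ 1 σ
  | assign (σ : State) (x : ℕ) (e : Expr) (h : e.Fits W σ) :
      Exec W (.assign x e) σ (e.cost + 1) (σ.setReg x (e.eval σ))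
  | store (σ : State) (a : ℕ) (i e : Expr) (hi : i.Fits W σ) (he : e.Fits W σ) :
      Exec W (.store a i e) σ (i.cost + e.cost + 1) (σ.setArr a (i.eval σ) (e.eval σ))
  | seq (p q : Program) (σ₁ σ₂ σ₃ : State) (s t : ℕ)
      (hp : Exec W p σ₁ s σ₂) (hq : Exec W q σ₂ t σ₃) : Exec W (.seq p q) σ₁ (s + t) σ₃
  | ite_true (e : Expr) (p q : Program) (σ τ : State) (t : ℕ) (h : e.Fits W σ)
      (he : e.eval σ ≠ 0) (hp : Exec W p σ t τ) : Exec W (.ite e p q) σ (e.cost + 1 + t) τ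
  | ite_false (e : Expr) (p q : Program) (σ τ : State) (t : ℕ) (h : e.Fits W σ)
      (he : e.eval σ = 0) (hq : Exec W q σ t τ) : Exec W (.ite e p q) σ (e.cost + 1 + t) τ
  | loop_true (e : Expr) (p : Program) (σ₁ σ₂ σ₃ : State) (s t : ℕ) (h : e.Fits W σ₁)
      (he : e.eval σ₁ ≠ 0) (hp : Exec W p σ₁ s σ₂) (hl : Exec W (.loop e p) σ₂ t σ₃) :
      Exec W (.loop e p) σ₁ (e.cost + 1 + s + t) σ₃
  | loop_false (e : Expr) (p : Program) (σ : State) (h : e.Fits W σ) (he : e.eval σ = 0) :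
      Exec W (.loop e p) σ (e.cost + 1) σ

/-- The initial state on input `l`: array `0` starts with the list `l`, and all else is `0`. -/
def State.init (l : List ℕ) : State where
  reg := fun _ => 0
  arr := fun a i => if a = 0 then l.getD i 0 else 0

/-- `Computes W p l t b`: on input `l` and with words of size at most `W`, the program `p` halts
after exactly `t` steps with the answer `b`, given in register `0` as `1` (yes) or `0` (no). -/
def Computes (W : ℕ) (p : Program) (l : List ℕ) (t : ℕ) (b : Prop) : Prop :=
  ∃ τ : State, Exec W p (State.init l) t τ ∧
    ((b ∧ τ.reg 0 = 1) ∨ (¬ b ∧ τ.reg 0 = 0))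

end RAM

/-- The input that consists of an expression tree over `w` labels and a number `k`: the number of
labels, the number `k`, the number of nodes, and the nodes in post-order. -/
def mcstInput {w : ℕ} (T : CWExpr w) (k : ℕ) : List ℕ :=
  [w, k, T.numNodes] ++ T.code

/-!
A spanning tree that is covered by `C` exists if and only if the edges with an end in `C` connect
the graph, that is, if every cut that is crossed by no such edge is trivial
(`minCoverSpanningTree_iff_uncut`). For a cut `X` it suffices to remember its *profile*: which
combinations of label, membership in `C` and side of `X` occur. There are `2 ^ O(w)` profiles. The
profile of a cut of a disjoint union is the bitwise disjunction of the profiles of its parts, a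
relabel node moves bits, and the profile tells whether the edges of a join node cross the cut. Hence
the set of the profiles of all uncrossed cuts, the *state* of `C`, can be computed along the
expression tree (`CWExpr.testBit_st`), and it tells in the end whether `C` is feasible
(`CWExpr.comb_four_eq_zero_iff`). There are `2 ^ 2 ^ O(w)` states, and the algorithm computes for
each node of the tree and each state the least size of a set with this state.

All nodes with children are treated alike. The table of a node is obtained by running through all
pairs of states of its children and all pairs of profiles in these states (`CWExpr.comb`,
`tabUpTo`); a node with one child gets the empty graph as another child. An additional node at the
root filters the profiles of nontrivial cuts, so that the feasible sets are those with the empty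
state. Since profiles and states are numbers below `2 ^ (4 * w + 4)` and `2 ^ 2 ^ (4 * w + 4)`, they
are handled by arithmetic on words, given a list of the powers of two.

The program is verified by a calculus of weakest preconditions with time bounds (`RAM.WP`). Its
assertions include bounds on all registers and arrays, some in terms of `w` only and others linear
in the length of the input. A syntactic condition on expressions, checked by computation, then
implies that no intermediate word is too large (`RAM.Expr.fits`). The tree is traversed in
post-order, where the left child of a union node is found from the recorded start of the subtree of
the right child; the correctness of the traversal is an induction on the expression tree
(`RAM.wp_tree`). -/

namespace CWExpr

/-! ### Profiles of cuts -/

/-- The weight `16 ^ (i + 1)` of label `i` in a profile. A profile has one hexadecimal digit for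
each label, and its last digit records which sides of the cut are inhabited. -/
def slot (i : ℕ) : ℕ := 2 ^ (4 * i + 4)

/-- The profile of a single vertex with a label of weight `a`; the arguments say whether the vertex
is in the cover and whether it is in the cut. -/
def mark (a : ℕ) : Bool → Bool → ℕ
  | true, true => a + 1
  | true, false => 2 * a + 2
  | false, true => 4 * a + 1
  | false, false => 8 * a + 2

/-- The bit of the last digit of a profile that stands for the side `x` of a cut. -/
def sideBit (x : Bool) : ℕ := if x then 0 else 1

/-- The bit of the digit of a label that stands for vertices of cover status `c` on side `x`. -/
def typeBit (c x : Bool) : ℕ := (if c then 0 else 2) + sideBit x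

theorem sideBit_lt (x : Bool) : sideBit x < 4 := by cases x <;> decide
theorem typeBit_lt (c x : Bool) : typeBit c x < 4 := by cases c <;> cases x <;> decide

theorem mark_slot (i : ℕ) (c x : Bool) :
    mark (slot i) c x = 2 ^ (4 * i + 4 + typeBit c x) ||| 2 ^ sideBit x := by
  have h : (2 : ℕ) ^ sideBit x < 2 ^ (4 * i + 4 + typeBit c x) :=
    Nat.pow_lt_pow_right (by norm_num) (by have := sideBit_lt x; omega)
  have := Nat.two_pow_add_eq_or_of_lt h 1
  rw [mul_one] at this
  rw [← this]
  cases c <;> cases x <;> simp [mark, slot, typeBit, sideBit, pow_add] <;> ring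

/-- A number that vanishes if and only if joining the labels of weights `a` and `b` creates no edge
that has an end in the cover and crosses the cut (`bad_eq_zero_iff`). It is written with the
arithmetic of the machine, so that it can be evaluated by a single expression. -/
def bad (a b z : ℕ) : ℕ :=
  z / a % 2 * (z / (2 * b) % 2 + z / (8 * b) % 2) + z / (4 * a) % 2 * (z / (2 * b) % 2) +
  z / b % 2 * (z / (2 * a) % 2 + z / (8 * a) % 2) + z / (4 * b) % 2 * (z / (2 * a) % 2)

/-- Whether a profile `z` survives at a node of kind `k` with labels of weights `a` and `b`. The
kinds `1`, `2`, `3` are those of union, relabel and join nodes; the additional kind `4` keeps the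
profiles of the cuts that have vertices on both sides. -/
def keep (k a b z : ℕ) : Prop :=
  (k = 3 → bad a b z = 0) ∧ (k = 4 → z % 4 = 3)

instance (k a b z : ℕ) : Decidable (keep k a b z) := inferInstanceAs (Decidable (_ ∧ _))

/-- The profile that `z` becomes at a node of kind `k`: at relabel nodes the digit of weight `a` is
erased and added to that of weight `b`. -/
def img (k a b z : ℕ) : ℕ :=
  z - (if k = 2 then 1 else 0) * (z / a % 16) * a ||| (if k = 2 then 1 else 0) * (z / a % 16) * b

/-- Subtracting a hexadecimal digit in its place clears its four bits. -/
theorem testBit_clear (z n p : ℕ) :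
    (z - (z / 2 ^ n % 16) * 2 ^ n).testBit p = (z.testBit p &&
        !(decide (n ≤ p) && decide (p < n + 4))) := by
  have h1 : z - (z / 2 ^ n % 16) * 2 ^ n = 2 ^ (n + 4) * (z / 2 ^ (n + 4)) + z % 2 ^ n := by
    have e1 := Nat.div_add_mod z (2 ^ n)
    have e2 := Nat.div_add_mod (z / 2 ^ n) 16
    have e3 : z / 2 ^ n / 16 = z / 2 ^ (n + 4) := by rw [Nat.div_div_eq_div_mul, pow_add]; norm_num
    rw [e3] at e2
    apply Nat.sub_eq_of_eq_add
    conv_lhs => rw [← e1, ← e2]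
    rw [pow_add]; ring
  have hlt : z % 2 ^ n < 2 ^ (n + 4) :=
    lt_of_lt_of_le (Nat.mod_lt _ (by positivity)) (Nat.pow_le_pow_right (by norm_num) (by omega))
  rw [h1, Nat.testBit_two_pow_mul_add _ hlt]
  by_cases hp : p < n + 4
  · rw [if_pos hp, Nat.testBit_mod_two_pow]
    by_cases hq : n ≤ p
    · simp [hp, hq]
    · simp [hq, not_le.mp hq]
  · rw [if_neg hp, Nat.testBit_div_two_pow, Nat.sub_add_cancel (not_lt.mp hp)]
    simp [hp]

theorem testBit_place (z n m p : ℕ) :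
    ((z / 2 ^ n % 16) * 2 ^ m).testBit p =
      (decide (m ≤ p) && decide (p < m + 4) && z.testBit (p - m + n)) := by
  rw [mul_comm, Nat.testBit_two_pow_mul, show (16 : ℕ) = 2 ^ 4 by norm_num,
    Nat.testBit_mod_two_pow, Nat.testBit_div_two_pow]
  by_cases h : m ≤ p
  · have : (p - m < 4) ↔ p < m + 4 := by omega
    simp [h, this]
  · simp [h]

theorem img_of_ne {k : ℕ} (hk : k ≠ 2) (a b z : ℕ) : img k a b z = z := by simp [img, hk]

theorem testBit_img_label (i j l e z : ℕ) (he : e < 4) :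
    (img 2 (slot i) (slot j) z).testBit (4 * l + 4 + e) =
      ((z.testBit (4 * l + 4 + e) && decide (l ≠ i)) ||
        (decide (l = j) && z.testBit (4 * i + 4 + e))) := by
  simp only [img, slot, if_true, one_mul, Nat.testBit_or, testBit_clear, testBit_place]
  congr 1
  · congr 1
    rw [Bool.eq_iff_iff]
    simp
    omega
  · by_cases h : l = j
    · subst h
      have : 4 * l + 4 + e - (4 * l + 4) + (4 * i + 4) = 4 * i + 4 + e := by omega
      simp only [this]
      simp [he]
    · have : ¬ (4 * j ≤ 4 * l + e ∧ 4 * l + e < 4 * j + 4) := by omega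
      simp [h]
      omega

theorem testBit_img_side (i j e z : ℕ) (he : e < 4) :
    (img 2 (slot i) (slot j) z).testBit e = z.testBit e := by
  simp only [img, slot, if_true, one_mul, Nat.testBit_or, testBit_clear, testBit_place]
  have h1 : ¬ (4 * i + 4 ≤ e) := by omega
  have h2 : ¬ (4 * j + 4 ≤ e) := by omega
  simp [h1, h2]

/-- A strict upper bound for all profiles over `w` labels. -/
def profNum (w : ℕ) : ℕ := 2 ^ (4 * w + 4)

theorem profNum_pos (w : ℕ) : 0 < profNum w := by simp [profNum]

/-- The number of states, that is, of sets of profiles, encoded as bit sets. -/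
def stateNum (w : ℕ) : ℕ := 2 ^ profNum w

theorem slot_mul_le {w i : ℕ} (h : i < w) : 16 * slot i ≤ profNum w := by
  unfold slot profNum
  calc 16 * 2 ^ (4 * i + 4) = 2 ^ (4 * (i + 1) + 4) := by ring
    _ ≤ _ := Nat.pow_le_pow_right (by norm_num) (by omega)

theorem sixteen_le_slot (i : ℕ) : 16 ≤ slot i := by
  unfold slot
  calc 16 = 2 ^ 4 := by norm_num
    _ ≤ _ := Nat.pow_le_pow_right (by norm_num) (by omega)

theorem mark_lt {w i : ℕ} (h : i < w) (c x : Bool) : mark (slot i) c x < profNum w := by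
  have := slot_mul_le h
  have := sixteen_le_slot i
  cases c <;> cases x <;> simp only [mark] <;> omega

theorem img_lt {w j : ℕ} (hj : j < w) (k a z : ℕ) (hz : z < profNum w) :
    img k a (slot j) z < profNum w := by
  apply Nat.or_lt_two_pow
  · exact lt_of_le_of_lt (Nat.sub_le _ _) hz
  · have h1 := slot_mul_le hj
    have h2 := sixteen_le_slot j
    have h3 : z / a % 16 < 16 := Nat.mod_lt _ (by norm_num)
    have h4 : (if k = 2 then 1 else 0) * (z / a % 16) ≤ 15 := by split_ifs <;> omega
    have : (if k = 2 then 1 else 0) * (z / a % 16) * slot j ≤ 15 * slot j :=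
      Nat.mul_le_mul_right _ h4
    change _ < profNum w
    omega

/-! ### States -/

/-- The part of `comb` contributed by the first `n` pairs of profiles, where the pair `(p, q)` has
the number `P * p + q`. -/
def combUpTo (P k a b s t : ℕ) : ℕ → ℕ
  | 0 => 0
  | n + 1 =>
    if s.testBit (n / P) ∧ t.testBit (n % P) ∧ keep k a b (n / P ||| n % P) then
      combUpTo P k a b s t n ||| 2 ^ img k a b (n / P ||| n % P)
    else combUpTo P k a b s t n

/-- The state of a node of kind `k` whose children have the states `s` and `t`: the set of the
surviving profiles among the images of `p ||| q` for `p ∈ s` and `q ∈ t`. A node with one child is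
handled as if its left child were the empty graph, whose state is `1`, the set `{0}`. -/
def comb (P k a b s t : ℕ) : ℕ := combUpTo P k a b s t (P * P)

theorem testBit_combUpTo (P k a b s t n u : ℕ) :
    (combUpTo P k a b s t n).testBit u ↔ ∃ x < n, s.testBit (x / P) ∧ t.testBit (x % P) ∧
      keep k a b (x / P ||| x % P) ∧ img k a b (x / P ||| x % P) = u := by
  induction n with
  | zero => simp [combUpTo]
  | succ n ih =>
    simp only [Nat.lt_succ_iff_lt_or_eq, or_and_right, exists_or, exists_eq_left, ← ih]
    rw [combUpTo]
    split_ifs with h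
    · simp only [Nat.testBit_or, Bool.or_eq_true, Nat.testBit_two_pow, decide_eq_true_eq]
      tauto
    · tauto

theorem testBit_comb (P k a b s t u : ℕ) :
    (comb P k a b s t).testBit u ↔ ∃ p < P, ∃ q < P, s.testBit p ∧ t.testBit q ∧
      keep k a b (p ||| q) ∧ img k a b (p ||| q) = u := by
  rw [comb, testBit_combUpTo]
  constructor
  · rintro ⟨x, hx, h⟩
    have hP : 0 < P := Nat.pos_of_ne_zero (by rintro rfl; simp at hx)
    exact ⟨x / P, Nat.div_lt_of_lt_mul hx, x % P, Nat.mod_lt _ hP, h⟩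
  · rintro ⟨p, hp, q, hq, h⟩
    have h1 : (P * p + q) / P = p := by
      rw [Nat.mul_add_div (by omega), Nat.div_eq_of_lt hq, add_zero]
    have h2 : (P * p + q) % P = q := by rw [Nat.mul_add_mod, Nat.mod_eq_of_lt hq]
    refine ⟨P * p + q, ?_, by rw [h1, h2]; exact h⟩
    calc P * p + q < P * p + P := by omega
      _ = P * (p + 1) := by ring
      _ ≤ P * P := Nat.mul_le_mul_left _ hp

theorem combUpTo_lt {w j : ℕ} (hj : j < w) (k a s t n : ℕ) (hn : n ≤ profNum w * profNum w) :
    combUpTo (profNum w) k a (slot j) s t n < stateNum w := by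
  induction n with
  | zero => simp [combUpTo, stateNum]
  | succ n ih =>
    have ih := ih (by omega)
    rw [combUpTo]
    split_ifs with h
    · refine Nat.or_lt_two_pow ih (Nat.pow_lt_pow_right (by norm_num) (img_lt hj _ _ _ ?_))
      exact Nat.or_lt_two_pow (Nat.div_lt_of_lt_mul hn) (Nat.mod_lt _ (by simp [profNum]))
    · exact ih

theorem comb_lt {w j : ℕ} (hj : j < w) (k a s t : ℕ) :
    comb (profNum w) k a (slot j) s t < stateNum w :=
  combUpTo_lt hj k a s t _ le_rfl

theorem testBit_comb_one {P : ℕ} (hP : 0 < P) (k a b t u : ℕ) :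
    (comb P k a b 1 t).testBit u ↔ ∃ q < P, t.testBit q ∧ keep k a b q ∧ img k a b q = u := by
  rw [testBit_comb]
  constructor
  · rintro ⟨p, -, q, hq, hp, h⟩
    rw [Nat.testBit_one_eq_true_iff_self_eq_zero] at hp
    subst hp
    rw [Nat.zero_or] at h
    exact ⟨q, hq, h⟩
  · rintro ⟨q, hq, h⟩
    exact ⟨0, hP, q, hq, rfl, by rwa [Nat.zero_or]⟩

variable {w : ℕ}

/-! ### Profiles and states of an expression tree -/

/-- The profile of a cut `X` with respect to a set `C` of vertices: the digit of label `i` records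
which combinations of membership in `C` and in `X` occur among the vertices labeled `i`. -/
def prof : (T : CWExpr w) → (T.Vert → Bool) → (T.Vert → Bool) → ℕ
  | intro i, C, X => mark (slot i) (C ()) (X ())
  | union s t, C, X => s.prof (C ∘ Sum.inl) (X ∘ Sum.inl) ||| t.prof (C ∘ Sum.inr) (X ∘ Sum.inr)
  | relabel i j t, C, X => img 2 (slot i) (slot j) (t.prof C X)
  | join _ _ t, C, X => t.prof C X

theorem prof_lt : (T : CWExpr w) → (C X : T.Vert → Bool) → T.prof C X < profNum w
  | intro i, _, _ => mark_lt i.2 _ _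
  | union s t, _, _ => Nat.or_lt_two_pow (prof_lt s _ _) (prof_lt t _ _)
  | relabel _ j t, C, X => img_lt j.2 _ _ _ (prof_lt t C X)
  | join _ _ t, C, X => prof_lt t C X

theorem testBit_prof_side : (T : CWExpr w) → (C X : T.Vert → Bool) → (e : ℕ) → e < 4 →
    ((T.prof C X).testBit e ↔ ∃ v, sideBit (X v) = e)
  | intro i, C, X, e, he => by
    have h : ¬ (4 * (i : ℕ) + 4 + typeBit (C ()) (X ()) = e) := by omega
    rw [prof, mark_slot]
    simp only [Nat.testBit_or, Nat.testBit_two_pow, h, decide_false, Bool.false_or,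
        decide_eq_true_eq]
    exact ⟨fun h => ⟨(), h⟩, fun ⟨_, h⟩ => h⟩
  | union s t, C, X, e, he => by
    rw [prof, Nat.testBit_or, Bool.or_eq_true, testBit_prof_side s _ _ e he,
      testBit_prof_side t _ _ e he]
    exact (Sum.exists (α := s.Vert) (β := t.Vert) (p := fun v => sideBit (X v) = e)).symm
  | relabel i j t, C, X, e, he => by
    rw [prof, testBit_img_side _ _ _ _ he, testBit_prof_side t C X e he]
    rfl
  | join _ _ t, C, X, e, he => testBit_prof_side t C X e he

theorem testBit_prof_label : (T : CWExpr w) → (C X : T.Vert → Bool) → (l : Fin w) →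
    (e : ℕ) → e < 4 →
    ((T.prof C X).testBit (4 * l + 4 + e) ↔ ∃ v, T.label v = l ∧ typeBit (C v) (X v) = e)
  | intro i, C, X, l, e, he => by
    have h1 : ¬ (sideBit (X ()) = 4 * (l : ℕ) + 4 + e) := by
      have := sideBit_lt (X ()); omega
    have h2 : (4 * (i : ℕ) + 4 + typeBit (C ()) (X ()) = 4 * (l : ℕ) + 4 + e) ↔
        i = l ∧ typeBit (C ()) (X ()) = e := by
      have := typeBit_lt (C ()) (X ())
      rw [Fin.ext_iff]; omega
    rw [prof, mark_slot]
    simp only [Nat.testBit_or, Nat.testBit_two_pow, h1, h2, decide_false, Bool.or_false,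
      decide_eq_true_eq]
    exact ⟨fun h => ⟨(), h⟩, fun ⟨_, h⟩ => h⟩
  | union s t, C, X, l, e, he => by
    rw [prof, Nat.testBit_or, Bool.or_eq_true, testBit_prof_label s _ _ l e he,
      testBit_prof_label t _ _ l e he]
    exact (Sum.exists (α := s.Vert) (β := t.Vert)
      (p := fun v => (s.union t).label v = l ∧ typeBit (C v) (X v) = e)).symm
  | relabel i j t, C, X, l, e, he => by
    rw [prof, testBit_img_label _ _ _ _ _ he, Bool.or_eq_true, Bool.and_eq_true, Bool.and_eq_true,
      testBit_prof_label t C X l e he, testBit_prof_label t C X i e he, decide_eq_true_eq,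
      decide_eq_true_eq]
    change _ ↔ ∃ v : t.Vert, (if t.label v = i then j else t.label v) = l ∧ _
    rw [ne_eq, ← Fin.ext_iff, ← Fin.ext_iff]
    constructor
    · rintro (⟨⟨v, h1, h2⟩, h3⟩ | ⟨h1, v, h2, h3⟩)
      · exact ⟨v, by rw [if_neg (by rwa [h1]), h1], h2⟩
      · exact ⟨v, by rw [if_pos h2, h1], h3⟩
    · rintro ⟨v, h1, h2⟩
      split_ifs at h1 with h
      · exact Or.inr ⟨h1.symm, v, h, h2⟩
      · exact Or.inl ⟨⟨v, h1, h2⟩, fun h' => h (h1.trans h')⟩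
  | join _ _ t, C, X, l, e, he => testBit_prof_label t C X l e he

/-- No edge with an end in `C` has its ends on different sides of `X`. -/
def Uncut {V : Type} (G : SimpleGraph V) (C X : V → Bool) : Prop :=
  ∀ u v, G.Adj u v → (C u ∨ C v) → X u = X v

theorem bad_eq_zero_iff (T : CWExpr w) (C X : T.Vert → Bool) (i j : Fin w) :
    bad (slot i) (slot j) (T.prof C X) = 0 ↔
      ∀ u v, T.label u = i → T.label v = j → (C u ∨ C v) → X u = X v := by
  have key : ∀ (l : Fin w) (e : ℕ), e < 4 → ∀ m, m = 2 ^ e →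
      (T.prof C X / (m * slot l) % 2 = 0 ↔ ¬ ∃ v, T.label v = l ∧ typeBit (C v) (X v) = e) := by
    intro l e he m hm
    rw [← testBit_prof_label T C X l e he, Nat.testBit_eq_decide_div_mod_eq, slot, hm, ← pow_add,
      add_comm e]
    simp
  have k0 := fun l => key l 0 (by norm_num) 1 (by norm_num)
  have k1 := fun l => key l 1 (by norm_num) 2 (by norm_num)
  have k2 := fun l => key l 2 (by norm_num) 4 (by norm_num)
  have k3 := fun l => key l 3 (by norm_num) 8 (by norm_num)
  simp only [one_mul] at k0
  have t0 : ∀ c x : Bool, typeBit c x = 0 ↔ c = true ∧ x = true := by decide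
  have t1 : ∀ c x : Bool, typeBit c x = 1 ↔ c = true ∧ x = false := by decide
  have t2 : ∀ c x : Bool, typeBit c x = 2 ↔ c = false ∧ x = true := by decide
  have t3 : ∀ c x : Bool, typeBit c x = 3 ↔ c = false ∧ x = false := by decide
  simp only [bad, Nat.add_eq_zero_iff, mul_eq_zero, k0, k1, k2, k3, t0, t1, t2, t3]
  constructor
  · rintro ⟨⟨⟨h1, h2⟩, h3⟩, h4⟩ u v hu hv hC
    grind
  · intro h
    grind

/-- The state of a set `C` of vertices, computed along the tree. It encodes the set of profiles of
the cuts that no edge covered by `C` crosses (`testBit_st`). -/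
def st : (T : CWExpr w) → (T.Vert → Bool) → ℕ
  | intro i, C => 2 ^ mark (slot i) (C ()) true ||| 2 ^ mark (slot i) (C ()) false
  | union s t, C =>
    comb (profNum w) 1 (slot 0) (slot 0) (s.st (C ∘ Sum.inl)) (t.st (C ∘ Sum.inr))
  | relabel i j t, C => comb (profNum w) 2 (slot i) (slot j) 1 (t.st C)
  | join i j t, C => comb (profNum w) 3 (slot i) (slot j) 1 (t.st C)

/-- There are no expression trees over zero labels. -/
theorem pos_of_expr : CWExpr w → 0 < w
  | intro i => i.pos
  | union s _ => pos_of_expr s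
  | relabel i _ _ => i.pos
  | join i _ _ => i.pos

theorem st_lt : (T : CWExpr w) → (C : T.Vert → Bool) → T.st C < stateNum w
  | intro i, _ => Nat.or_lt_two_pow (Nat.pow_lt_pow_right (by norm_num) (mark_lt i.2 _ _))
      (Nat.pow_lt_pow_right (by norm_num) (mark_lt i.2 _ _))
  | union s _, _ => comb_lt (pos_of_expr s) _ _ _ _
  | relabel _ j _, _ => comb_lt j.2 _ _ _ _
  | join _ j _, _ => comb_lt j.2 _ _ _ _

/-- The state of `C` is the set of the profiles of all cuts that are not crossed by edges covered
by `C`. At a union node such cuts are the pairs of such cuts of the two parts; a join node only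
removes cuts, and whether it removes a cut depends only on the profile. -/
theorem testBit_st : (T : CWExpr w) → (C : T.Vert → Bool) → (p : ℕ) →
    ((T.st C).testBit p ↔ ∃ X, Uncut T.graph C X ∧ T.prof C X = p)
  | intro i, C, p => by
    rw [st, Nat.testBit_or, Bool.or_eq_true, Nat.testBit_two_pow, Nat.testBit_two_pow,
      decide_eq_true_eq, decide_eq_true_eq]
    constructor
    · rintro (h | h)
      · exact ⟨fun _ => true, fun _ _ _ _ => rfl, h⟩
      · exact ⟨fun _ => false, fun _ _ _ _ => rfl, h⟩
    · rintro ⟨X, -, h⟩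
      change mark (slot i) (C ()) (X ()) = p at h
      cases hX : X ()
      · exact Or.inr (by rw [← h, hX])
      · exact Or.inl (by rw [← h, hX])
  | union s t, C, p => by
    have hk : ∀ z, keep 1 (slot 0) (slot 0) z := fun z => ⟨by norm_num, by norm_num⟩
    simp only [st, testBit_comb, testBit_st s, testBit_st t, img_of_ne (show 1 ≠ 2 by norm_num), hk,
      true_and]
    constructor
    · rintro ⟨_, -, _, -, ⟨X, hX, rfl⟩, ⟨Y, hY, rfl⟩, rfl⟩
      refine ⟨Sum.elim X Y, ?_, rfl⟩
      rintro (u | u) (v | v) h hC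
      · exact hX u v h hC
      · exact absurd h (by simp [graph])
      · exact absurd h (by simp [graph])
      · exact hY u v h hC
    · rintro ⟨X, hX, rfl⟩
      exact ⟨_, prof_lt _ _ _, _, prof_lt _ _ _,
        ⟨X ∘ Sum.inl, fun u v h hC => hX (Sum.inl u) (Sum.inl v) h hC, rfl⟩,
        ⟨X ∘ Sum.inr, fun u v h hC => hX (Sum.inr u) (Sum.inr v) h hC, rfl⟩, rfl⟩
  | relabel i j t, C, p => by
    have hk : ∀ z, keep 2 (slot i) (slot j) z := fun z => ⟨by norm_num, by norm_num⟩
    have key : ∀ C : t.Vert → Bool, (comb (profNum w) 2 (slot i) (slot j) 1 (t.st C)).testBit p ↔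
        ∃ X, Uncut t.graph C X ∧ img 2 (slot i) (slot j) (t.prof C X) = p := by
      intro C
      simp only [testBit_comb_one (profNum_pos w), testBit_st t, hk, true_and]
      constructor
      · rintro ⟨_, -, ⟨X, hX, rfl⟩, h⟩
        exact ⟨X, hX, h⟩
      · rintro ⟨X, hX, h⟩
        exact ⟨_, prof_lt t C X, ⟨X, hX, rfl⟩, h⟩
    exact key C
  | join i j t, C, p => by
    have key : ∀ C : t.Vert → Bool, (comb (profNum w) 3 (slot i) (slot j) 1 (t.st C)).testBit p ↔
        ∃ X, Uncut (V := t.Vert) (join i j t).graph C X ∧ t.prof C X = p := by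
      intro C
      have hk : ∀ X, keep 3 (slot i) (slot j) (t.prof C X) ↔
          ∀ u v, t.label u = i → t.label v = j → (C u ∨ C v) → X u = X v := by
        intro X
        rw [← bad_eq_zero_iff]
        simp [keep]
      have hU : ∀ X, Uncut (V := t.Vert) (join i j t).graph C X ↔ Uncut t.graph C X ∧
          ∀ u v, t.label u = i → t.label v = j → (C u ∨ C v) → X u = X v := by
        intro X
        constructor
        · intro h
          refine ⟨fun u v e => h u v (Or.inl e), fun u v hu hv hC => ?_⟩
          by_cases huv : u = v
          · rw [huv]
          · exact h u v (Or.inr ((SimpleGraph.fromRel_adj _ _ _).mpr ⟨huv, Or.inl ⟨hu, hv⟩⟩)) hC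
        · rintro ⟨h1, h2⟩ u v (e | e) hC
          · exact h1 u v e hC
          · obtain ⟨-, ⟨hu, hv⟩ | ⟨hv, hu⟩⟩ := (SimpleGraph.fromRel_adj _ _ _).mp e
            · exact h2 u v hu hv hC
            · exact (h2 v u hv hu hC.symm).symm
      simp only [testBit_comb_one (profNum_pos w), testBit_st t, img_of_ne (show 3 ≠ 2 by norm_num)]
      constructor
      · rintro ⟨_, -, ⟨X, hX, rfl⟩, h, h'⟩
        exact ⟨X, (hU X).mpr ⟨hX, (hk X).mp h⟩, h'⟩
      · rintro ⟨X, hX, h'⟩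
        exact ⟨_, prof_lt t C X, ⟨X, ((hU X).mp hX).1, rfl⟩, (hk X).mpr ((hU X).mp hX).2, h'⟩
    exact key C

/-- Keeping only the profiles of nontrivial cuts leaves nothing if and only if the edges covered by
`C` connect the graph. -/
theorem comb_four_eq_zero_iff (T : CWExpr w) (C : T.Vert → Bool) (a b : ℕ) :
    comb (profNum w) 4 a b 1 (T.st C) = 0 ↔
      ∀ X, Uncut T.graph C X → ∀ u v, X u = X v := by
  have hk : ∀ X, keep 4 a b (T.prof C X) ↔ ∃ u v, X u ≠ X v := by
    intro X
    have h0 := testBit_prof_side T C X 0 (by norm_num)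
    have h1 := testBit_prof_side T C X 1 (by norm_num)
    have s0 : ∀ x, sideBit x = 0 ↔ x = true := by decide
    have s1 : ∀ x, sideBit x = 1 ↔ x = false := by decide
    simp only [s0, s1] at h0 h1
    rw [Nat.testBit_eq_decide_div_mod_eq, decide_eq_true_eq] at h0 h1
    have h3 : keep 4 a b (T.prof C X) ↔
        (T.prof C X / 2 ^ 0 % 2 = 1 ∧ T.prof C X / 2 ^ 1 % 2 = 1) := by
      norm_num [keep]
      omega
    rw [h3, h0, h1]
    constructor
    · rintro ⟨⟨u, hu⟩, v, hv⟩
      exact ⟨u, v, by simp [hu, hv]⟩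
    · rintro ⟨u, v, h⟩
      cases hu : X u <;> cases hv : X v <;> simp_all
      · exact ⟨⟨v, hv⟩, u, hu⟩
      · exact ⟨⟨u, hu⟩, v, hv⟩
  have h0 : ∀ n : ℕ, n = 0 ↔ ∀ p, ¬ n.testBit p := fun n =>
    ⟨by rintro rfl; simp, fun h => Nat.zero_of_testBit_eq_false fun p => by simpa using h p⟩
  rw [h0]
  simp only [testBit_comb_one (profNum_pos w), testBit_st]
  constructor
  · intro h X hX u v
    by_contra hne
    exact h _ ⟨_, prof_lt T C X, ⟨X, hX, rfl⟩, (hk X).mpr ⟨u, v, hne⟩, rfl⟩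
  · rintro h p ⟨_, -, ⟨X, hX, rfl⟩, hkeep, -⟩
    obtain ⟨u, v, hne⟩ := (hk X).mp hkeep
    exact hne (h X hX u v)

theorem finite_vert : (T : CWExpr w) → Finite T.Vert
  | intro _ => inferInstanceAs (Finite Unit)
  | union s t =>
    have := finite_vert s
    have := finite_vert t
    inferInstanceAs (Finite (s.Vert ⊕ t.Vert))
  | relabel _ _ t => finite_vert t
  | join _ _ t => finite_vert t

/-! ### Costs and spanning trees -/

/-- The number of vertices of `C`, computed along the tree. -/
def cost : (T : CWExpr w) → (T.Vert → Bool) → ℕ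
  | intro _, C => if C () then 1 else 0
  | union s t, C => s.cost (C ∘ Sum.inl) + t.cost (C ∘ Sum.inr)
  | relabel _ _ t, C => t.cost C
  | join _ _ t, C => t.cost C

theorem cost_le : (T : CWExpr w) → (C : T.Vert → Bool) → T.cost C ≤ T.numNodes
  | intro _, C => by rw [cost, numNodes]; split_ifs <;> simp
  | union s t, C => by
    have h1 := cost_le s (C ∘ Sum.inl)
    have h2 := cost_le t (C ∘ Sum.inr)
    rw [cost, numNodes]
    omega
  | relabel _ _ t, C => (cost_le t C).trans (Nat.le_succ _)
  | join _ _ t, C => (cost_le t C).trans (Nat.le_succ _)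

theorem cost_eq : (T : CWExpr w) → (C : T.Vert → Bool) → T.cost C = Nat.card {v // C v = true}
  | intro _, C => by
    change (if C () then 1 else 0) = Nat.card {v : Unit // C v = true}
    split_ifs with h
    · have : Unique {v : Unit // C v = true} := ⟨⟨⟨(), h⟩⟩, fun _ => rfl⟩
      exact Nat.card_unique.symm
    · have : IsEmpty {v : Unit // C v = true} := ⟨fun v => h v.2⟩
      exact Nat.card_of_isEmpty.symm
  | union s t, C => by
    have := finite_vert s
    have := finite_vert t
    rw [cost, cost_eq s, cost_eq t, ← Nat.card_sum]
    exact Nat.card_congr (Equiv.subtypeSum (α := s.Vert) (β := t.Vert)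
        (p := fun v => C v = true)).symm
  | relabel _ _ t, C => cost_eq t C
  | join _ _ t, C => cost_eq t C

end CWExpr

open CWExpr

/-- A spanning tree covered by `C` is a spanning tree of the subgraph of the edges with an end in
`C`; it exists if and only if this subgraph is connected, that is, has no nontrivial cut. -/
theorem minCoverSpanningTree_iff_uncut {V : Type} [Finite V] [Nonempty V] (G : SimpleGraph V)
    (k : ℕ) :
    MinCoverSpanningTree G k ↔ ∃ C : V → Bool, Nat.card {v // C v = true} ≤ k ∧
      ∀ X, Uncut G C X → ∀ u v, X u = X v := by
  classical
  have := Fintype.ofFinite V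
  constructor
  · rintro ⟨T, hTG, hT, C, hC, hk⟩
    refine ⟨fun v => decide (v ∈ C), by simpa using hk, fun X hX u v => ?_⟩
    obtain ⟨p⟩ := hT.connected u v
    induction p with
    | nil => rfl
    | cons h _ ih => exact (hX _ _ (hTG h) (by simpa using hC h)).trans ih
  · rintro ⟨C, hk, h⟩
    let H : SimpleGraph V := G ⊓ SimpleGraph.fromRel fun u _ => C u = true
    have hH : H.Connected := by
      refine ⟨fun u v => ?_⟩
      have := h (fun x => decide (H.Reachable u x)) ?_ u v
      · simpa using this
      · intro x y hxy hC
        have hadj : H.Adj x y := ⟨hxy, (SimpleGraph.fromRel_adj _ _ _).mpr ⟨hxy.ne, hC⟩⟩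
        rw [decide_eq_decide]
        exact ⟨fun r => r.trans hadj.reachable, fun r => r.trans hadj.symm.reachable⟩
    obtain ⟨T, hTH, hT⟩ := hH.exists_isTree_le
    refine ⟨T, hTH.trans inf_le_left, hT, Finset.univ.filter fun v => C v = true, ?_, ?_⟩
    · intro u v huv
      have := ((SimpleGraph.fromRel_adj _ _ _).mp (hTH huv).2).2
      simpa using this
    · rwa [Nat.card_eq_fintype_card, Fintype.card_subtype] at hk

theorem minCoverSpanningTree_iff_comb {w : ℕ} (T : CWExpr w) {V : Type} [Fintype V]
    (G : SimpleGraph V)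
    (k a b : ℕ) (hT : T.IsExprOf G) (hG : G.Connected) :
    MinCoverSpanningTree G k ↔
      ∃ C, T.cost C ≤ k ∧ comb (profNum w) 4 a b 1 (T.st C) = 0 := by
  obtain ⟨e⟩ := hT
  have := hG.nonempty
  rw [minCoverSpanningTree_iff_uncut]
  simp only [comb_four_eq_zero_iff, cost_eq]
  constructor
  · rintro ⟨C, hk, h⟩
    refine ⟨C ∘ e, ?_, fun X hX u v => ?_⟩
    · exact (Nat.card_congr (e.toEquiv.subtypeEquiv fun _ => Iff.rfl)).trans_le hk
    · have := h (X ∘ e.symm) (fun u v huv hC => hX _ _ (e.symm.map_adj_iff.mpr huv)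
        (by simpa using hC))
        (e u) (e v)
      simpa using this
  · rintro ⟨C, hk, h⟩
    refine ⟨C ∘ e.symm, ?_, fun X hX u v => ?_⟩
    · exact (Nat.card_congr (e.symm.toEquiv.subtypeEquiv fun _ => Iff.rfl)).trans_le hk
    · have := h (X ∘ e) (fun u v huv hC => hX _ _ (e.map_adj_iff.mpr huv) (by simpa using hC))
        (e.symm u) (e.symm v)
      simpa using this

/-! ### Tables -/

/-- A table stores at a state `s` one more than the least cost of a set with state `s`, or `0` if
there is none; `AtMost f s b` says that the least cost that the table `f` gives for `s` is at most
`b`. -/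
def AtMost (f : ℕ → ℕ) (s b : ℕ) : Prop := f s ≠ 0 ∧ f s ≤ b + 1

/-- The table of a node of kind `k` whose children have the tables `f` and `g`, after the first `n`
pairs of states have been considered. The pair `(s, t)` has the number `S * s + t`. -/
def tabUpTo (P S k a b : ℕ) (f g : ℕ → ℕ) : ℕ → ℕ → ℕ
  | 0 => fun _ => 0
  | n + 1 =>
    if 0 < f (n / S) ∧ 0 < g (n % S) ∧
        (tabUpTo P S k a b f g n (comb P k a b (n / S) (n % S)) = 0 ∨
          f (n / S) + g (n % S) - 1 < tabUpTo P S k a b f g n (comb P k a b (n / S) (n % S))) then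
      Function.update (tabUpTo P S k a b f g n) (comb P k a b (n / S) (n % S))
        (f (n / S) + g (n % S) - 1)
    else tabUpTo P S k a b f g n

theorem atMost_tabUpTo (P S k a b : ℕ) (f g : ℕ → ℕ) (n u c : ℕ) :
    AtMost (tabUpTo P S k a b f g n) u c ↔ ∃ x < n, 0 < f (x / S) ∧ 0 < g (x % S) ∧
      f (x / S) + g (x % S) - 1 ≤ c + 1 ∧ comb P k a b (x / S) (x % S) = u := by
  induction n with
  | zero => simp [tabUpTo, AtMost]
  | succ n ih =>
    simp only [Nat.lt_succ_iff_lt_or_eq, or_and_right, exists_or, exists_eq_left]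
    rw [← ih, tabUpTo]
    clear ih
    generalize tabUpTo P S k a b f g n = h
    by_cases hu : comb P k a b (n / S) (n % S) = u
    · subst hu
      split_ifs <;> simp only [AtMost, Function.update_self, and_true] <;> omega
    · have (v : ℕ) : AtMost (Function.update h (comb P k a b (n / S) (n % S)) v) u c ↔
          AtMost h u c := by rw [AtMost, Function.update_of_ne (Ne.symm hu), AtMost]
      split_ifs <;> simp [hu, this]

theorem atMost_tab (P S k a b : ℕ) (f g : ℕ → ℕ) (u c : ℕ) :
    AtMost (tabUpTo P S k a b f g (S * S)) u c ↔ ∃ s < S, ∃ t < S, ∃ c₁ c₂, c₁ + c₂ ≤ c ∧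
      AtMost f s c₁ ∧ AtMost g t c₂ ∧ comb P k a b s t = u := by
  rw [atMost_tabUpTo]
  constructor
  · rintro ⟨x, hx, h1, h2, h3, h4⟩
    have hS : 0 < S := Nat.pos_of_ne_zero (by rintro rfl; simp at hx)
    exact ⟨x / S, Nat.div_lt_of_lt_mul hx, x % S, Nat.mod_lt _ hS, f (x / S) - 1, g (x % S) - 1,
      by omega, ⟨by omega, by omega⟩, ⟨by omega, by omega⟩, h4⟩
  · rintro ⟨p, hp, q, hq, c₁, c₂, hc, ⟨h1, h2⟩, ⟨h3, h4⟩, h⟩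
    have e1 : (S * p + q) / S = p := by
      rw [Nat.mul_add_div (by omega), Nat.div_eq_of_lt hq, add_zero]
    have e2 : (S * p + q) % S = q := by rw [Nat.mul_add_mod, Nat.mod_eq_of_lt hq]
    refine ⟨S * p + q, ?_, ?_⟩
    · calc S * p + q < S * p + S := by omega
        _ = S * (p + 1) := by ring
        _ ≤ S * S := Nat.mul_le_mul_left _ hp
    · rw [e1, e2]
      exact ⟨by omega, by omega, by omega, h⟩

/-- `f` is the table of the tree `T`. -/
def IsTable {w : ℕ} (T : CWExpr w) (f : ℕ → ℕ) : Prop :=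
  ∀ s < stateNum w, ∀ c, AtMost f s c ↔ ∃ C, T.st C = s ∧ T.cost C ≤ c

theorem IsTable.le {w : ℕ} {T : CWExpr w} {f : ℕ → ℕ} (h : IsTable T f) {s : ℕ}
    (hs : s < stateNum w) : f s ≤ T.numNodes + 1 := by
  by_cases h0 : f s = 0
  · omega
  · obtain ⟨C, hC, -⟩ := (h s hs (f s)).mp ⟨h0, by omega⟩
    exact ((h s hs T.numNodes).mpr ⟨C, hC, T.cost_le C⟩).2

/-- The table of the empty graph: it has only the empty set of vertices, and only the empty cut. -/
def emptyTab (s : ℕ) : ℕ := if s = 1 then 1 else 0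

theorem one_lt_stateNum (w : ℕ) : 1 < stateNum w :=
  Nat.one_lt_two_pow (profNum_pos w).ne'

theorem atMost_emptyTab {s c : ℕ} : AtMost emptyTab s c ↔ s = 1 := by
  by_cases h : s = 1 <;> simp [AtMost, emptyTab, h]

/-- The empty graph contributes nothing, so combining its table with that of `T` transforms the
states of `T` and keeps the costs. -/
theorem atMost_tab_empty {w : ℕ} (T : CWExpr w) {g : ℕ → ℕ} (hg : IsTable T g) {f : ℕ → ℕ}
    (hf : ∀ s < stateNum w, f s = emptyTab s) (k a b u c : ℕ) :
    AtMost (tabUpTo (profNum w) (stateNum w) k a b f g (stateNum w * stateNum w)) u c ↔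
      ∃ C, comb (profNum w) k a b 1 (T.st C) = u ∧ T.cost C ≤ c := by
  rw [atMost_tab]
  constructor
  · rintro ⟨s, hs, t, ht, c₁, c₂, hc, h1, h2, h3⟩
    have h1' : s = 1 := by
      rw [← atMost_emptyTab (c := c₁)]
      unfold AtMost at h1 ⊢
      rwa [← hf s hs]
    subst h1'
    obtain ⟨C, rfl, hC⟩ := (hg t ht c₂).mp h2
    exact ⟨C, h3, by omega⟩
  · rintro ⟨C, h, hC⟩
    refine ⟨1, one_lt_stateNum w, T.st C, T.st_lt C, 0, c, by omega, ?_, ?_, h⟩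
    · unfold AtMost
      rw [hf 1 (one_lt_stateNum w)]
      exact atMost_emptyTab.mpr rfl
    · exact (hg _ (T.st_lt C) c).mpr ⟨C, rfl, hC⟩

theorem isTable_relabel {w : ℕ} (T : CWExpr w) (i j : Fin w) {f g : ℕ → ℕ} (hg : IsTable T g)
    (hf : ∀ s < stateNum w, f s = emptyTab s) :
    IsTable (.relabel i j T)
      (tabUpTo (profNum w) (stateNum w) 2 (slot i) (slot j) f g (stateNum w * stateNum w)) :=
  fun _ _ _ => atMost_tab_empty T hg hf _ _ _ _ _

theorem isTable_join {w : ℕ} (T : CWExpr w) (i j : Fin w) {f g : ℕ → ℕ} (hg : IsTable T g)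
    (hf : ∀ s < stateNum w, f s = emptyTab s) :
    IsTable (.join i j T)
      (tabUpTo (profNum w) (stateNum w) 3 (slot i) (slot j) f g (stateNum w * stateNum w)) :=
  fun _ _ _ => atMost_tab_empty T hg hf _ _ _ _ _

theorem isTable_union {w : ℕ} (T₁ T₂ : CWExpr w) {f g : ℕ → ℕ} (hf : IsTable T₁ f)
    (hg : IsTable T₂ g) :
    IsTable (.union T₁ T₂)
      (tabUpTo (profNum w) (stateNum w) 1 (slot 0) (slot 0) f g (stateNum w * stateNum w)) := by
  intro u hu c
  rw [atMost_tab]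
  constructor
  · rintro ⟨s, hs, t, ht, c₁, c₂, hc, h1, h2, h3⟩
    obtain ⟨C₁, rfl, hC₁⟩ := (hf s hs c₁).mp h1
    obtain ⟨C₂, rfl, hC₂⟩ := (hg t ht c₂).mp h2
    refine ⟨Sum.elim C₁ C₂, h3, ?_⟩
    change T₁.cost C₁ + T₂.cost C₂ ≤ c
    omega
  · rintro ⟨C, h, hC⟩
    exact ⟨_, T₁.st_lt _, _, T₂.st_lt _, _, _, hC,
      (hf _ (T₁.st_lt _) _).mpr ⟨_, rfl, le_rfl⟩, (hg _ (T₂.st_lt _) _).mpr ⟨_, rfl, le_rfl⟩, h⟩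

theorem isTable_intro {w : ℕ} (i : Fin w) {f : ℕ → ℕ} (h : ∀ s < stateNum w, f s =
      if s = 2 ^ mark (slot i) false true ||| 2 ^ mark (slot i) false false then 1
      else if s = 2 ^ mark (slot i) true true ||| 2 ^ mark (slot i) true false then 2 else 0) :
    IsTable (.intro i) f := by
  intro s hs c
  rw [AtMost, h s hs]
  constructor
  · intro h
    split_ifs at h with h1 h2
    · exact ⟨fun _ => false, h1.symm, Nat.zero_le _⟩
    · refine ⟨fun _ => true, h2.symm, ?_⟩
      change 1 ≤ c
      omega
    · simp at h
  · rintro ⟨C, rfl, hC⟩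
    change (if C () then 1 else 0) ≤ c at hC
    cases hc : C ()
    · simp [st, hc]
    · simp only [hc, if_true] at hC
      simp only [st, hc, if_true]
      split_ifs <;> omega

namespace RAM

/-! ### Expressions and their word sizes -/

instance (n : ℕ) : OfNat Expr n := ⟨.lit n⟩
instance : Add Expr := ⟨.op .add⟩
instance : Sub Expr := ⟨.op .sub⟩
instance : Mul Expr := ⟨.op .mul⟩
instance : Div Expr := ⟨.op .div⟩
instance : Mod Expr := ⟨.op .mod⟩
instance : OrOp Expr := ⟨.op .or⟩

namespace Expr

/-- The test whether `e` and `f` have the same value. -/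
def eq (e f : Expr) : Expr := .op .eq e f
/-- The test whether `e` has a smaller value than `f`. -/
def lt (e f : Expr) : Expr := .op .lt e f

section
variable (σ : State) (e f : Expr)
@[simp] theorem eval_ofNat (n : ℕ) : (ofNat(n) : Expr).eval σ = OfNat.ofNat n := rfl
@[simp] theorem eval_reg (x : ℕ) : (Expr.reg x).eval σ = σ.reg x := rfl
@[simp] theorem eval_get (a : ℕ) : (Expr.get a e).eval σ = σ.arr a (e.eval σ) := rfl
@[simp] theorem eval_add : (e + f).eval σ = e.eval σ + f.eval σ := rfl
@[simp] theorem eval_sub : (e - f).eval σ = e.eval σ - f.eval σ := rfl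
@[simp] theorem eval_mul : (e * f).eval σ = e.eval σ * f.eval σ := rfl
@[simp] theorem eval_div : (e / f).eval σ = e.eval σ / f.eval σ := rfl
@[simp] theorem eval_mod : (e % f).eval σ = e.eval σ % f.eval σ := rfl
@[simp] theorem eval_or : (e ||| f).eval σ = e.eval σ ||| f.eval σ := rfl
@[simp] theorem eval_eq : (e.eq f).eval σ = if e.eval σ = f.eval σ then 1 else 0 := rfl
@[simp] theorem eval_lt : (e.lt f).eval σ = if e.eval σ < f.eval σ then 1 else 0 := rfl
end

/-- The number of leaves and array accesses of an expression. -/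
def size : Expr → ℕ
  | lit _ => 1
  | reg _ => 1
  | get _ i => i.size + 1
  | op _ e f => e.size + f.size

/-- The degree of an expression in the length of the input: registers from `10` on and array `1`
hold words that are bounded in terms of the number of labels, all other words may grow linearly
with the input. -/
def degree : Expr → ℕ
  | lit _ => 0
  | reg x => if x < 10 then 1 else 0
  | get a _ => if a = 1 then 0 else 1
  | op .mul e f => e.degree + f.degree
  | op .div e _ => e.degree
  | op .mod e _ => e.degree
  | op .lt _ _ => 0
  | op .eq _ _ => 0
  | op _ e f => max e.degree f.degree

/-- A syntactic condition under which no word in the evaluation of the expression grows faster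
than linearly with the input. -/
def tame : Expr → Bool
  | lit c => c ≤ 16
  | reg _ => true
  | get _ i => i.tame
  | op o e f => e.tame && f.tame && decide ((op o e f).degree ≤ 1)

end Expr

/-- The bound for the words in register `x`: `M` bounds what depends on the number of labels only,
and `Y` the length of the input. -/
def regBound (M Y x : ℕ) : ℕ := if x < 10 then M * Y else M

/-- The bound for the words in array `a`. -/
def arrBound (M Y a : ℕ) : ℕ := if a = 1 then M else M * Y

/-- All registers and arrays respect their bounds. -/
structure Bounded (M Y : ℕ) (σ : State) : Prop where
  reg : ∀ x, σ.reg x ≤ regBound M Y x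
  arr : ∀ a i, σ.arr a i ≤ arrBound M Y a

/-- The word bound `W` leaves room for the evaluation of every tame expression of size up to `128`
in a bounded state. -/
structure Room (M Y W : ℕ) : Prop where
  sixteen_le : 16 ≤ M
  one_le : 1 ≤ Y
  le : M ^ 128 * Y ≤ W

theorem or_le_add (x y : ℕ) : x ||| y ≤ x + y := by
  induction x using Nat.strong_induction_on generalizing y with
  | _ x ih =>
    rcases Nat.eq_zero_or_pos x with rfl | hx
    · simp
    · have h1 := ih (x / 2) (by omega) (y / 2)
      rw [← Nat.or_div_two] at h1
      have h2 : (x ||| y) % 2 ≤ x % 2 + y % 2 := by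
        have : (x ||| y) % 2 = 1 ↔ x % 2 = 1 ∨ y % 2 = 1 := Nat.or_mod_two_eq_one
        omega
      omega

theorem Expr.one_le_size : (e : Expr) → 1 ≤ e.size
  | .lit _ => le_rfl
  | .reg _ => le_rfl
  | .get _ _ => Nat.le_add_left _ _
  | .op _ e _ => (one_le_size e).trans (Nat.le_add_right _ _)

/-- The value of a tame expression is bounded by a monomial that is read off its syntax. -/
theorem Expr.eval_le {M Y : ℕ} {σ : State} (hM : 16 ≤ M) (hY : 1 ≤ Y) (hσ : Bounded M Y σ) :
    (e : Expr) → e.tame = true → e.eval σ ≤ M ^ e.size * Y ^ e.degree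
  | .lit c, h => by
    have : c ≤ 16 := by simpa [tame] using h
    simp only [eval, size, degree, pow_one, pow_zero, mul_one]
    omega
  | .reg x, _ => by
    have := hσ.reg x
    simp only [eval, size, degree, regBound] at this ⊢
    split_ifs at this ⊢ <;> simpa using this
  | .get a i, h => by
    have h1 := hσ.arr a (i.eval σ)
    have h2 : arrBound M Y a ≤ M * Y ^ (if a = 1 then 0 else 1) := by
      rw [arrBound]; split_ifs <;> simp
    simp only [eval, size, degree]
    refine (h1.trans h2).trans (Nat.mul_le_mul_right _ ?_)
    exact Nat.le_self_pow (by omega) M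
  | .op o e f, h => by
    simp only [tame, Bool.and_eq_true, decide_eq_true_eq] at h
    obtain ⟨⟨he, hf⟩, -⟩ := h
    have h1 := eval_le hM hY hσ e he
    have h2 := eval_le hM hY hσ f hf
    have pe : ∀ n m, 0 < M ^ n * Y ^ m := fun n m => by positivity
    have two : ∀ e : Expr, 2 ≤ M ^ e.size := fun e =>
      le_trans (by omega) (Nat.le_self_pow (by have := e.one_le_size; omega) M)
    have hsum : M ^ e.size + M ^ f.size ≤ M ^ (e.size + f.size) := by
      rw [pow_add]; exact Nat.add_le_mul (two e) (two f)
    have hle : M ^ e.size ≤ M ^ (e.size + f.size) := Nat.pow_le_pow_right (by omega) (by omega)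
    have hmax : e.eval σ + f.eval σ ≤ M ^ (e.size + f.size) * Y ^ max e.degree f.degree :=
      calc e.eval σ + f.eval σ ≤ M ^ e.size * Y ^ max e.degree f.degree
            + M ^ f.size * Y ^ max e.degree f.degree :=
          add_le_add (h1.trans (Nat.mul_le_mul_left _ (Nat.pow_le_pow_right hY (le_max_left _ _))))
            (h2.trans (Nat.mul_le_mul_left _ (Nat.pow_le_pow_right hY (le_max_right _ _))))
        _ ≤ _ := by rw [← add_mul]; exact Nat.mul_le_mul_right _ hsum
    have hleft : e.eval σ ≤ M ^ (e.size + f.size) * Y ^ e.degree :=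
      h1.trans (Nat.mul_le_mul_right _ hle)
    cases o <;> simp only [eval, size, degree, Op.eval]
    · exact hmax
    · exact le_trans (by omega) hmax
    · calc _ ≤ _ := Nat.mul_le_mul h1 h2
        _ = _ := by ring
    · exact (Nat.div_le_self _ _).trans hleft
    · exact (Nat.mod_le _ _).trans hleft
    · exact le_trans (Nat.and_le_left.trans (by omega)) hmax
    · exact (or_le_add _ _).trans hmax
    · have := pe (e.size + f.size) 0; split_ifs <;> omega
    · have := pe (e.size + f.size) 0; split_ifs <;> omega

theorem Expr.fits {M Y W : ℕ} {σ : State} (hR : Room M Y W) (hσ : Bounded M Y σ) :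
    (e : Expr) → e.tame = true → e.degree ≤ 1 → e.size ≤ 128 → e.Fits W σ := by
  have hM := hR.sixteen_le
  have hY := hR.one_le
  have main : ∀ e : Expr, e.tame = true → e.degree ≤ 1 → e.size ≤ 128 → e.eval σ ≤ W := by
    intro e h1 h2 h3
    refine ((Expr.eval_le hM hY hσ e h1).trans (Nat.mul_le_mul ?_ ?_)).trans hR.le
    · exact Nat.pow_le_pow_right (by omega) h3
    · exact (Nat.pow_le_pow_right hY h2).trans_eq (pow_one Y)
  intro e
  induction e with
  | lit c => exact main (.lit c)
  | reg x => exact main (.reg x)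
  | get a i ih =>
    intro h1 h2 h3
    have hi : i.degree ≤ 1 := degree_le_one i h1
    refine ⟨ih h1 hi (by simp only [size] at h3; omega), main (.get a i) h1 h2 h3⟩
  | op o e f ihe ihf =>
    intro h1 h2 h3
    have h := h1
    simp only [tame, Bool.and_eq_true, decide_eq_true_eq] at h
    simp only [size] at h3
    exact ⟨ihe h.1.1 (degree_le_one e h.1.1) (by omega), ihf h.1.2 (degree_le_one f h.1.2)
        (by omega),
      main (.op o e f) h1 h2 h3⟩
where
  degree_le_one : (e : Expr) → e.tame = true → e.degree ≤ 1
    | .lit _, _ => Nat.zero_le _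
    | .reg x, _ => by simp only [degree]; split_ifs <;> simp
    | .get a _, _ => by simp only [degree]; split_ifs <;> simp
    | .op o e f, h => by
      simp only [tame, Bool.and_eq_true, decide_eq_true_eq] at h
      exact h.2

/-- The decidable condition on expressions that makes all words in their evaluation fit. -/
def Expr.ok (e : Expr) : Bool := e.tame && decide (e.size ≤ 128)

theorem Expr.fits_of_ok {M Y W : ℕ} {σ : State} {e : Expr} (h : e.ok = true) (hR : Room M Y W)
    (hσ : Bounded M Y σ) : e.Fits W σ := by
  simp only [ok, Bool.and_eq_true, decide_eq_true_eq] at h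
  exact Expr.fits hR hσ e h.1 (Expr.fits.degree_le_one e h.1) h.2

theorem Bounded.setReg {M Y : ℕ} {σ : State} (h : Bounded M Y σ) {x v : ℕ}
    (hv : v ≤ regBound M Y x) :
    Bounded M Y (σ.setReg x v) where
  reg y := by
    by_cases hy : y = x
    · subst hy; simpa [State.setReg] using hv
    · simpa [State.setReg, hy] using h.reg y
  arr := h.arr

theorem Bounded.setArr {M Y : ℕ} {σ : State} (h : Bounded M Y σ) {a i v : ℕ}
    (hv : v ≤ arrBound M Y a) : Bounded M Y (σ.setArr a i v) where
  reg := h.reg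
  arr b j := by
    by_cases hb : b = a
    · subst hb
      by_cases hj : j = i
      · subst hj; simpa [State.setArr] using hv
      · simpa [State.setArr, hj] using h.arr b j
    · simpa [State.setArr, hb] using h.arr b j

/-! ### Program verification -/

/-- Started in the state `σ`, if that is bounded, the program `p` halts within `n` steps in a
bounded state that satisfies `Q`, and all words that it uses are at most `W`. -/
def WP (M Y W : ℕ) (p : Program) (n : ℕ) (Q : State → Prop) (σ : State) : Prop :=
  Bounded M Y σ → ∃ t τ, t ≤ n ∧ Exec W p σ t τ ∧ Bounded M Y τ ∧ Q τ

section
variable {M Y W n : ℕ} {p q : Program} {Q : State → Prop} {σ : State} {e i : Expr}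

theorem WP.mono {m : ℕ} {R : State → Prop} (h : WP M Y W p m R σ) (hQ : ∀ τ, R τ → Q τ)
    (hn : m ≤ n) :
    WP M Y W p n Q σ := fun hσ =>
  let ⟨t, τ, h1, h2, h3, h4⟩ := h hσ
  ⟨t, τ, h1.trans hn, h2, h3, hQ τ h4⟩

theorem WP.time {m : ℕ} (h : WP M Y W p m Q σ) (hn : m ≤ n) : WP M Y W p n Q σ :=
  h.mono (fun _ => id) hn

theorem WP.skip (h : Q σ) : WP M Y W .skip 1 Q σ := fun hσ => ⟨1, σ, le_rfl, .skip σ, hσ, h⟩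

theorem WP.assign (hR : Room M Y W) {x : ℕ} (he : e.ok = true) (hv : e.eval σ ≤ regBound M Y x)
    (hQ : Q (σ.setReg x (e.eval σ))) : WP M Y W (.assign x e) (e.cost + 1) Q σ := fun hσ =>
  ⟨_, _, le_rfl, .assign σ x e (Expr.fits_of_ok he hR hσ), hσ.setReg hv, hQ⟩

theorem WP.store (hR : Room M Y W) {a : ℕ} (hi : i.ok = true) (he : e.ok = true)
    (hv : e.eval σ ≤ arrBound M Y a) (hQ : Q (σ.setArr a (i.eval σ) (e.eval σ))) :
    WP M Y W (.store a i e) (i.cost + e.cost + 1) Q σ := fun hσ =>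
  ⟨_, _, le_rfl, .store σ a i e (Expr.fits_of_ok hi hR hσ) (Expr.fits_of_ok he hR hσ),
    hσ.setArr hv, hQ⟩

theorem WP.seq {m : ℕ} (h : WP M Y W p m (WP M Y W q n Q) σ) : WP M Y W (.seq p q) (m + n) Q σ :=
  fun hσ =>
    let ⟨_, _, h1, h2, h3, h4⟩ := h hσ
    let ⟨_, _, h5, h6, h7, h8⟩ := h4 h3
    ⟨_, _, add_le_add h1 h5, .seq _ _ _ _ _ _ _ h2 h6, h7, h8⟩

theorem WP.ite (hR : Room M Y W) {m : ℕ} (he : e.ok = true) (hp : e.eval σ ≠ 0 → WP M Y W p m Q σ)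
    (hq : e.eval σ = 0 → WP M Y W q n Q σ) :
    WP M Y W (.ite e p q) (e.cost + 1 + max m n) Q σ := fun hσ => by
  by_cases h : e.eval σ = 0
  · obtain ⟨t, τ, h1, h2, h3, h4⟩ := hq h hσ
    exact ⟨_, τ, Nat.add_le_add_left (h1.trans (le_max_right _ _)) _,
      .ite_false e p q σ τ t (Expr.fits_of_ok he hR hσ) h h2, h3, h4⟩
  · obtain ⟨t, τ, h1, h2, h3, h4⟩ := hp h hσ
    exact ⟨_, τ, Nat.add_le_add_left (h1.trans (le_max_left _ _)) _,
      .ite_true e p q σ τ t (Expr.fits_of_ok he hR hσ) h h2, h3, h4⟩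

theorem WP.loop_true (hR : Room M Y W) {m : ℕ} (he : e.ok = true) (h : e.eval σ ≠ 0)
    (hp : WP M Y W p m (WP M Y W (.loop e p) n Q) σ) :
    WP M Y W (.loop e p) (n + (e.cost + 1 + m)) Q σ := fun hσ =>
  let ⟨_, _, h1, h2, h3, h4⟩ := hp hσ
  let ⟨_, _, h5, h6, h7, h8⟩ := h4 h3
  ⟨_, _, by omega, .loop_true _ _ _ _ _ _ _ (Expr.fits_of_ok he hR hσ) h h2 h6, h7, h8⟩

theorem WP.loop_false (hR : Room M Y W) (he : e.ok = true) (h : e.eval σ = 0) (hQ : Q σ) :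
    WP M Y W (.loop e p) (e.cost + 1) Q σ := fun hσ =>
  ⟨_, _, le_rfl, .loop_false _ _ _ (Expr.fits_of_ok he hR hσ) h, hσ, hQ⟩

/-- The rule for loops with a counter that runs from `a` to `b`. -/
theorem WP.for (hR : Room M Y W) {m : ℕ} (he : e.ok = true) (I : ℕ → State → Prop) {a b : ℕ}
    (hab : a ≤ b)
    (hI : I a σ) (h1 : ∀ x τ, a ≤ x → x < b → I x τ → e.eval τ ≠ 0 ∧ WP M Y W p m (I (x + 1)) τ)
    (h2 : ∀ τ, I b τ → e.eval τ = 0 ∧ Q τ) :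
    WP M Y W (.loop e p) (e.cost + 1 + (b - a) * (e.cost + 1 + m)) Q σ := by
  obtain ⟨d, rfl⟩ := Nat.exists_eq_add_of_le hab
  induction d generalizing a σ with
  | zero => exact (WP.loop_false hR he (h2 σ hI).1 (h2 σ hI).2).time (by omega)
  | succ d ih =>
    obtain ⟨g1, g2⟩ := h1 a σ le_rfl (by omega) hI
    refine (WP.loop_true hR he g1 (g2.mono (fun τ hτ => ?_) le_rfl)).time
      (n := e.cost + 1 + (a + (d + 1) - a) * (e.cost + 1 + m))
      (m := e.cost + 1 + (a + 1 + d - (a + 1)) * (e.cost + 1 + m) + (e.cost + 1 + m)) ?_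
    · refine ih hτ (Nat.le_add_right _ _) (fun x τ hx hx' => h1 x τ (by omega) (by omega)) ?_
      intro τ hτ
      exact h2 τ (by rwa [show a + (d + 1) = a + 1 + d by ring])
    · rw [show a + (d + 1) - a = d + 1 by omega, show a + 1 + d - (a + 1) = d by omega]
      ring_nf
      rfl
end

/-! ### The program for one table

The names of registers end in `R` and those of arrays in `A`. -/

local notation "ansR" => (0 : ℕ)
local notation "nodeR" => (1 : ℕ)
local notation "leftR" => (2 : ℕ)
local notation "rightR" => (3 : ℕ)
local notation "newR" => (4 : ℕ)
local notation "valR" => (5 : ℕ)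
local notation "profR" => (10 : ℕ)
local notation "stateR" => (11 : ℕ)
local notation "kindR" => (12 : ℕ)
local notation "aR" => (13 : ℕ)
local notation "bR" => (14 : ℕ)
local notation "yR" => (15 : ℕ)
local notation "sR" => (16 : ℕ)
local notation "tR" => (17 : ℕ)
local notation "uR" => (18 : ℕ)
local notation "xR" => (19 : ℕ)
local notation "zR" => (20 : ℕ)
local notation "limR" => (21 : ℕ)
local notation "inA" => (0 : ℕ)
local notation "powA" => (1 : ℕ)
local notation "tabA" => (2 : ℕ)
local notation "prevA" => (3 : ℕ)

theorem State.reg_setReg (σ : State) (x v y : ℕ) :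
    (σ.setReg x v).reg y = if y = x then v else σ.reg y := by
  simp [State.setReg, Function.update_apply]

theorem State.arr_setReg (σ : State) (x v : ℕ) : (σ.setReg x v).arr = σ.arr := rfl

theorem State.reg_setArr (σ : State) (a i v : ℕ) : (σ.setArr a i v).reg = σ.reg := rfl

theorem State.arr_setArr (σ : State) (a i v b : ℕ) :
    (σ.setArr a i v).arr b = if b = a then Function.update (σ.arr a) i v else σ.arr b := by
  simp [State.setArr, Function.update_apply]

/-- The bound for the words that do not depend on the length of the tree. -/
def wordBound (w : ℕ) : ℕ := stateNum w ^ 4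

theorem profNum_lt_stateNum (w : ℕ) : profNum w < stateNum w := Nat.lt_two_pow_self

theorem sq_stateNum_le (w : ℕ) : stateNum w * stateNum w ≤ wordBound w := by
  rw [wordBound, ← pow_two]
  exact Nat.pow_le_pow_right (one_lt_stateNum w).le (by norm_num)

theorem stateNum_le_wordBound (w : ℕ) : stateNum w ≤ wordBound w :=
  (Nat.le_mul_of_pos_left _ (one_lt_stateNum w).le).trans (sq_stateNum_le w)

theorem sq_profNum_le (w : ℕ) : profNum w * profNum w ≤ wordBound w :=
  (Nat.mul_le_mul (profNum_lt_stateNum w).le (profNum_lt_stateNum w).le).trans (sq_stateNum_le w)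

/-- The words and the powers of two that depend on `w` only have been computed. -/
structure Ready (w : ℕ) (σ : State) : Prop where
  prof : σ.reg profR = profNum w
  state : σ.reg stateR = stateNum w
  pow : ∀ x ≤ profNum w, σ.arr powA x = 2 ^ x

/-- The expression for `bad`. -/
def badE (a b z : Expr) : Expr :=
  z / a % 2 * (z / (2 * b) % 2 + z / (8 * b) % 2) + z / (4 * a) % 2 * (z / (2 * b) % 2) +
  z / b % 2 * (z / (2 * a) % 2 + z / (8 * a) % 2) + z / (4 * b) % 2 * (z / (2 * a) % 2)

/-- The expression for `keep`. -/
def keepE (k a b z : Expr) : Expr :=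
  ((k.eq 3) * badE a b z + (k.eq 4) * (((z % 4).eq 3).eq 0)).eq 0

/-- The expression for `img`. -/
def imgE (k a b z : Expr) : Expr :=
  (z - (k.eq 2) * (z / a % 16) * a) ||| ((k.eq 2) * (z / a % 16) * b)

theorem eval_keepE (k a b z : Expr) (σ : State) :
    (keepE k a b z).eval σ ≠ 0 ↔ keep (k.eval σ) (a.eval σ) (b.eval σ) (z.eval σ) := by
  have h : (badE a b z).eval σ = bad (a.eval σ) (b.eval σ) (z.eval σ) := rfl
  simp only [keepE, keep, Expr.eval_eq, Expr.eval_add, Expr.eval_mul, Expr.eval_mod,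
      Expr.eval_ofNat, h]
  by_cases h3 : k.eval σ = 3
  · simp [h3]
  · by_cases h4 : k.eval σ = 4
    · by_cases hz : z.eval σ % 4 = 3 <;> simp [h4, hz]
    · simp [h3, h4]

theorem eval_imgE (k a b z : Expr) (σ : State) :
    (imgE k a b z).eval σ = img (k.eval σ) (a.eval σ) (b.eval σ) (z.eval σ) := rfl

open Program in
/-- One pair of profiles: its number is in register `19`, the state so far in register `18`. -/
def combBody : Program :=
  seq (assign zR (.reg xR / .reg profR ||| .reg xR % .reg profR))
  (seq (ite (.reg sR / .get powA (.reg xR / .reg profR) % 2 *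
      (.reg tR / .get powA (.reg xR % .reg profR) % 2) *
      keepE (.reg kindR) (.reg aR) (.reg bR) (.reg zR))
    (assign uR (.reg uR ||| .get powA (imgE (.reg kindR) (.reg aR) (.reg bR) (.reg zR))))
    skip)
  (assign xR (.reg xR + 1)))

open Program in
/-- Compute `comb` of the states in registers `16` and `17` into register `18`. -/
def combProgram : Program :=
  seq (assign uR 0) (seq (assign xR 0)
    (loop (Expr.lt (.reg xR) (.reg profR * .reg profR)) combBody))

section
variable {w Y W : ℕ} {σ : State}

theorem wp_combBody (hR : Room (wordBound w) Y W) (hσ : Ready w σ) {j : ℕ} (hj : j < w)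
    (hb : σ.reg bR = slot j) {x : ℕ} (hx : σ.reg xR = x) (hxP : x < profNum w * profNum w)
    (hu : σ.reg uR = combUpTo (profNum w) (σ.reg kindR) (σ.reg aR) (slot j) (σ.reg sR)
      (σ.reg tR) x) :
    WP (wordBound w) Y W combBody 512 (fun τ => τ.arr = σ.arr ∧ τ.reg xR = x + 1 ∧
      τ.reg uR = combUpTo (profNum w) (σ.reg kindR) (σ.reg aR) (slot j) (σ.reg sR) (σ.reg tR)
        (x + 1) ∧
      ∀ r, r ≠ uR → r ≠ xR → r ≠ zR → τ.reg r = σ.reg r) σ := by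
  have hz1 : x / profNum w < profNum w := Nat.div_lt_of_lt_mul hxP
  have hz2 : x % profNum w < profNum w := Nat.mod_lt _ (profNum_pos w)
  have hz : x / profNum w ||| x % profNum w < profNum w := Nat.or_lt_two_pow hz1 hz2
  have hP := (profNum_lt_stateNum w).le.trans (stateNum_le_wordBound w)
  have hx' : x + 1 ≤ wordBound w := Nat.le_trans hxP (sq_profNum_le w)
  have hi := img_lt hj (σ.reg kindR) (σ.reg aR) _ hz
  have hstep := combUpTo_lt hj (σ.reg kindR) (σ.reg aR) (σ.reg sR) (σ.reg tR) (x + 1) hxP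
  have hcond : ∀ v, (Expr.reg sR / .get powA (.reg xR / .reg profR) % 2 *
      (.reg tR / .get powA (.reg xR % .reg profR) % 2) *
      keepE (.reg kindR) (.reg aR) (.reg bR) (.reg zR)).eval (σ.setReg zR v) ≠ 0 ↔
      (σ.reg sR).testBit (x / profNum w) ∧ (σ.reg tR).testBit (x % profNum w) ∧
        keep (σ.reg kindR) (σ.reg aR) (slot j) v := by
    intro v
    rw [Expr.eval_mul, mul_ne_zero_iff, eval_keepE]
    simp [State.reg_setReg, State.arr_setReg, hx, hσ.prof, hσ.pow _ hz1.le, hσ.pow _ hz2.le, hb,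
      Nat.testBit_eq_decide_div_mod_eq, and_assoc]
  refine WP.time (WP.seq (WP.assign hR rfl ?_ (WP.seq (WP.ite hR rfl (fun h => WP.assign hR rfl ?_
    (WP.assign hR rfl ?_ ?_)) (fun h => WP.skip (WP.assign hR rfl ?_ ?_)))))) (by decide)
  · simpa [regBound, hx, hσ.prof] using hz.le.trans hP
  all_goals simp only [Expr.eval_or, Expr.eval_div, Expr.eval_mod, Expr.eval_reg, hx,
    hσ.prof] at h ⊢
  · rw [hcond] at h
    rw [combUpTo, if_pos h, ← hu, ← hσ.pow _ hi.le] at hstep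
    simpa [regBound, State.reg_setReg, State.arr_setReg, eval_imgE, hb] using
      hstep.le.trans (stateNum_le_wordBound w)
  · simpa [regBound, State.reg_setReg, State.arr_setReg, hx] using hx'
  · rw [hcond] at h
    rw [combUpTo, if_pos h, ← hu, ← hσ.pow _ hi.le]
    simp [State.reg_setReg, State.arr_setReg, eval_imgE, hb, hx]
    intros; simp_all
  · simpa [regBound, State.reg_setReg, State.arr_setReg, hx] using hx'
  · rw [← not_ne_iff, hcond] at h
    rw [combUpTo, if_neg h, ← hu]
    simp [State.reg_setReg, State.arr_setReg, hx]
    intros; simp_all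

theorem wp_comb (hR : Room (wordBound w) Y W) (hσ : Ready w σ) {j : ℕ} (hj : j < w)
    (hb : σ.reg bR = slot j) :
    WP (wordBound w) Y W combProgram (1024 * (profNum w * profNum w)) (fun τ => τ.arr = σ.arr ∧
      τ.reg uR = comb (profNum w) (σ.reg kindR) (σ.reg aR) (slot j) (σ.reg sR) (σ.reg tR) ∧
      ∀ r, r ≠ uR → r ≠ xR → r ≠ zR → τ.reg r = σ.reg r) σ := by
  refine WP.time (WP.seq (WP.assign hR rfl (by simp) (WP.seq (WP.assign hR rfl (by simp)
    (WP.for hR rfl (m := 512) (a := 0) (b := profNum w * profNum w)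
    (fun x τ => τ.arr = σ.arr ∧ τ.reg xR = x ∧
      τ.reg uR = combUpTo (profNum w) (σ.reg kindR) (σ.reg aR) (slot j) (σ.reg sR) (σ.reg tR) x ∧
      ∀ r, r ≠ uR → r ≠ xR → r ≠ zR → τ.reg r = σ.reg r) (Nat.zero_le _) ?_ ?_ ?_))))) ?_
  · simp [State.reg_setReg, State.arr_setReg, combUpTo]
    intros; simp_all
  · rintro x τ - hx ⟨ha, h1, h2, h3⟩
    have hτ : Ready w τ := ⟨by rw [h3 _ (by decide) (by decide) (by decide), hσ.prof],
      by rw [h3 _ (by decide) (by decide) (by decide), hσ.state],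
      fun x hx => by rw [ha, hσ.pow x hx]⟩
    refine ⟨by simp [h1, hτ.prof, hx], (wp_combBody hR hτ hj ?_ h1 hx ?_).mono ?_ le_rfl⟩
    · rw [h3 _ (by decide) (by decide) (by decide), hb]
    · simpa [h3] using h2
    · rintro ρ ⟨g1, g2, g3, g4⟩
      refine ⟨g1.trans ha, g2, by simpa [h3] using g3, fun r hr1 hr2 hr3 => ?_⟩
      rw [g4 r hr1 hr2 hr3, h3 r hr1 hr2 hr3]
  · rintro τ ⟨ha, h1, h2, h3⟩
    exact ⟨by simp [h1, h3, hσ.prof], ha, h2, h3⟩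
  · have := profNum_pos w
    have : 0 < profNum w * profNum w := by positivity
    have hc : (Expr.lt (.reg xR) (.reg profR * .reg profR)).cost = 5 := rfl
    have hc0 : (0 : Expr).cost = 1 := rfl
    rw [hc, hc0]
    omega

open Program in
/-- One pair of states: its number is in register `15`. The combined state is computed, and its
entry in the new table is lowered to the combined cost if this is an improvement. As entries are one
more than costs, the combined entry is the sum of the two entries minus one. -/
def tabBody : Program :=
  seq (assign sR (.reg yR / .reg stateR))
  (seq (assign tR (.reg yR % .reg stateR))
  (seq combProgram
  (seq (assign valR (.get tabA (.reg leftR + .reg sR) + .get tabA (.reg rightR + .reg tR) - 1))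
  (seq (ite (Expr.lt 0 (.get tabA (.reg leftR + .reg sR)) *
      Expr.lt 0 (.get tabA (.reg rightR + .reg tR)) *
      (Expr.eq (.get tabA (.reg newR + .reg uR)) 0 +
        Expr.lt (.reg valR) (.get tabA (.reg newR + .reg uR))))
    (store tabA (.reg newR + .reg uR) (.reg valR))
    skip)
  (assign yR (.reg yR + 1))))))

open Program in
/-- Compute the table at the address in register `4` from the tables at the addresses in registers
`2` and `3`. -/
def tabProgram : Program :=
  seq (assign yR 0) (loop (Expr.lt (.reg yR) (.reg stateR * .reg stateR)) tabBody)

/-- The array `f` with the table `g` of `S` entries written at the address `n`. -/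
def place (f : ℕ → ℕ) (n S : ℕ) (g : ℕ → ℕ) (c : ℕ) : ℕ :=
  if n ≤ c ∧ c < n + S then g (c - n) else f c

theorem place_add {f : ℕ → ℕ} {n S : ℕ} {g : ℕ → ℕ} {s : ℕ} (hs : s < S) :
    place f n S g (n + s) = g s := by
  rw [place, if_pos ⟨by omega, by omega⟩, Nat.add_sub_cancel_left]

theorem place_of_lt {f : ℕ → ℕ} {n S : ℕ} {g : ℕ → ℕ} {c : ℕ} (hc : c < n) :
    place f n S g c = f c := if_neg (by omega)

theorem place_of_le {f : ℕ → ℕ} {n S : ℕ} {g : ℕ → ℕ} {c : ℕ} (hc : n + S ≤ c) :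
    place f n S g c = f c := if_neg (by omega)

theorem update_place {f : ℕ → ℕ} {n S : ℕ} {g : ℕ → ℕ} {u v : ℕ} (hu : u < S) :
    Function.update (place f n S g) (n + u) v = place f n S (Function.update g u v) := by
  funext c
  by_cases hc : c = n + u
  · subst hc
    simp [place_add hu]
  · rw [Function.update_of_ne hc]
    unfold place
    split_ifs with h
    · rw [Function.update_of_ne (by omega)]
    · rfl

/-- The situation before `tabProgram` computes a table from the tables `f` and `g`, whose entries
are at most `B` and which lie in front of the new table. -/
structure TabReady (w j B : ℕ) (f g : ℕ → ℕ) (σ : State) : Prop extends Ready w σ where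
  hb : σ.reg bR = slot j
  left : ∀ s < stateNum w, σ.arr tabA (σ.reg leftR + s) = f s
  right : ∀ s < stateNum w, σ.arr tabA (σ.reg rightR + s) = g s
  left_le : ∀ s < stateNum w, f s ≤ B
  right_le : ∀ s < stateNum w, g s ≤ B
  left_lt : σ.reg leftR + stateNum w ≤ σ.reg newR
  right_lt : σ.reg rightR + stateNum w ≤ σ.reg newR

/-- The table computed from `f` and `g` after `n` pairs of states, with the parameters taken from
the registers. -/
def tabOf (w : ℕ) (σ : State) (f g : ℕ → ℕ) (n : ℕ) : ℕ → ℕ :=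
  tabUpTo (profNum w) (stateNum w) (σ.reg kindR) (σ.reg aR) (σ.reg bR) f g n

/-- The state `τ` arises from `σ` when the first `n` pairs of states have been considered. Apart
from the new table, only register `5` and registers from `15` on have changed. -/
structure TabStep (w : ℕ) (f g : ℕ → ℕ) (n : ℕ) (σ τ : State) : Prop where
  arr : ∀ a, a ≠ tabA → τ.arr a = σ.arr a
  tab : τ.arr tabA = place (σ.arr tabA) (σ.reg newR) (stateNum w) (tabOf w σ f g n)
  y : τ.reg yR = n
  reg : ∀ r, r ≠ valR → r < yR → τ.reg r = σ.reg r

theorem TabStep.trans {f g : ℕ → ℕ} {n m : ℕ} {ρ τ : State} (h : TabStep w f g n σ τ)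
    (h1 : ∀ a, a ≠ tabA → ρ.arr a = τ.arr a)
    (h2 : ρ.arr tabA = place (σ.arr tabA) (σ.reg newR) (stateNum w) (tabOf w σ f g m))
    (h3 : ρ.reg yR = m) (h4 : ∀ r, r ≠ valR → r < yR → ρ.reg r = τ.reg r) :
    TabStep w f g m σ ρ where
  arr a ha := (h1 a ha).trans (h.arr a ha)
  tab := h2
  y := h3
  reg r hr hr' := (h4 r hr hr').trans (h.reg r hr hr')

theorem wp_tabBody (hR : Room (wordBound w) Y W) {j B : ℕ} {f g : ℕ → ℕ} (hj : j < w)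
    (hσ : TabReady w j B f g σ) (hB : 2 * B ≤ wordBound w * Y) {n : ℕ}
    (hn : n < stateNum w * stateNum w) {τ : State} (hτ : TabStep w f g n σ τ) :
    WP (wordBound w) Y W tabBody (1024 * (profNum w * profNum w) + 128)
      (TabStep w f g (n + 1) σ) τ := by
  have hS := stateNum_le_wordBound w
  have hs : n / stateNum w < stateNum w := Nat.div_lt_of_lt_mul hn
  have ht : n % stateNum w < stateNum w := Nat.mod_lt _ (one_lt_stateNum w).le
  have hn' : n + 1 ≤ wordBound w := Nat.le_trans hn (sq_stateNum_le w)
  have hP : τ.reg profR = profNum w := by rw [hτ.reg _ (by decide) (by decide), hσ.prof]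
  have hSt : τ.reg stateR = stateNum w := by rw [hτ.reg _ (by decide) (by decide), hσ.state]
  have hk : τ.reg kindR = σ.reg kindR := hτ.reg _ (by decide) (by decide)
  have ha : τ.reg aR = σ.reg aR := hτ.reg _ (by decide) (by decide)
  have hb : τ.reg bR = σ.reg bR := hτ.reg _ (by decide) (by decide)
  have hl : τ.reg leftR = σ.reg leftR := hτ.reg _ (by decide) (by decide)
  have hr : τ.reg rightR = σ.reg rightR := hτ.reg _ (by decide) (by decide)
  have hnew : τ.reg newR = σ.reg newR := hτ.reg _ (by decide) (by decide)
  have hT : ∀ c, τ.arr tabA c = place (σ.arr tabA) (σ.reg newR) (stateNum w) (tabOf w σ f g n) c :=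
    fun c => congrFun hτ.tab c
  have hlT : ∀ s < stateNum w, τ.arr tabA (σ.reg leftR + s) = f s := fun s hs => by
    rw [hT, place_of_lt (by have := hσ.left_lt; omega), hσ.left s hs]
  have hrT : ∀ s < stateNum w, τ.arr tabA (σ.reg rightR + s) = g s := fun s hs => by
    rw [hT, place_of_lt (by have := hσ.right_lt; omega), hσ.right s hs]
  have hv : f (n / stateNum w) + g (n % stateNum w) - 1 ≤ 2 * B := by
    have := hσ.left_le _ hs
    have := hσ.right_le _ ht
    omega
  have hu := comb_lt hj (σ.reg kindR) (σ.reg aR) (n / stateNum w) (n % stateNum w)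
  refine WP.time (WP.seq (WP.assign hR rfl ?_ (WP.seq (WP.assign hR rfl ?_ (WP.seq (n := 120)
    ((wp_comb hR (j := j) ?_ hj ?_).mono (fun ρ hρ => ?_) le_rfl)))))) ?_
  · simpa [regBound, hτ.y, hSt] using hs.le.trans hS
  · simpa [regBound, hτ.y, hSt, State.reg_setReg] using ht.le.trans hS
  · constructor
    · simpa [State.reg_setReg] using hP
    · simpa [State.reg_setReg] using hSt
    · intro x hx
      rw [State.arr_setReg, State.arr_setReg, hτ.arr _ (by decide), hσ.pow x hx]
  · simpa [State.reg_setReg, hb] using hσ.hb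
  · obtain ⟨g1, g2, g3⟩ := hρ
    simp only [State.arr_setReg] at g1
    simp [State.reg_setReg, hτ.y, hSt, hk, ha] at g2
    have g4 : ∀ r, r < yR → ρ.reg r = τ.reg r := fun r hr => by
      rw [g3 r (by omega) (by omega) (by omega), State.reg_setReg, if_neg (by omega),
        State.reg_setReg, if_neg (by omega)]
    have gy : ρ.reg yR = n := by
      rw [g3 _ (by decide) (by decide) (by decide), State.reg_setReg, if_neg (by decide),
        State.reg_setReg, if_neg (by decide), hτ.y]
    have gs : ρ.reg sR = n / stateNum w := by
      rw [g3 _ (by decide) (by decide) (by decide)]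
      simp [State.reg_setReg, hτ.y, hSt]
    have gt : ρ.reg tR = n % stateNum w := by
      rw [g3 _ (by decide) (by decide) (by decide)]
      simp [State.reg_setReg, hτ.y, hSt]
    have gl : ρ.reg leftR = σ.reg leftR := (g4 _ (by decide)).trans hl
    have gr : ρ.reg rightR = σ.reg rightR := (g4 _ (by decide)).trans hr
    have gn : ρ.reg newR = σ.reg newR := (g4 _ (by decide)).trans hnew
    have hbσ := hσ.hb
    have hcell : place (σ.arr tabA) (σ.reg newR) (stateNum w) (tabOf w σ f g n)
        (σ.reg newR + comb (profNum w) (σ.reg kindR) (σ.reg aR) (slot j) (n / stateNum w)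
          (n % stateNum w)) =
        tabOf w σ f g n (comb (profNum w) (σ.reg kindR) (σ.reg aR) (slot j) (n / stateNum w)
          (n % stateNum w)) := place_add hu
    have hsucc : tabOf w σ f g (n + 1) = if 0 < f (n / stateNum w) ∧ 0 < g (n % stateNum w) ∧
        (tabOf w σ f g n (comb (profNum w) (σ.reg kindR) (σ.reg aR) (slot j) (n / stateNum w)
            (n % stateNum w)) = 0 ∨
          f (n / stateNum w) + g (n % stateNum w) - 1 <
            tabOf w σ f g n (comb (profNum w) (σ.reg kindR) (σ.reg aR) (slot j) (n / stateNum w)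
              (n % stateNum w))) then
        Function.update (tabOf w σ f g n) (comb (profNum w) (σ.reg kindR) (σ.reg aR) (slot j)
          (n / stateNum w) (n % stateNum w)) (f (n / stateNum w) + g (n % stateNum w) - 1)
        else tabOf w σ f g n := by
      rw [← hbσ]
      rfl
    refine WP.time (WP.seq (WP.assign hR rfl ?_ (WP.seq (WP.ite hR rfl
      (fun h => WP.store hR rfl rfl ?_ (WP.assign hR rfl ?_ ?_))
      (fun h => WP.skip (WP.assign hR rfl ?_ ?_)))))) (by decide)
    · simpa [regBound, gl, gs, gr, gt, g1, hlT _ hs, hrT _ ht] using hv.trans hB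
    all_goals
      simp [gl, gs, gr, gt, gn, g1, g2, gy, hlT _ hs, hrT _ ht, State.reg_setReg, State.arr_setReg,
        State.reg_setArr, hτ.tab, hcell, -not_and, -not_or, -imp_false] at h ⊢
    · simpa [arrBound] using hv.trans hB
    · simpa [regBound] using hn'
    · rw [if_pos (by tauto)] at hsucc
      refine hτ.trans (fun a ha => ?_) ?_ ?_ (fun r hr hr' => ?_)
      · rw [State.arr_setReg, State.arr_setArr, if_neg ha, State.arr_setReg, g1]
      · rw [State.arr_setReg, State.arr_setArr, if_pos rfl, State.arr_setReg, g1, hτ.tab,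
          update_place hu, hsucc]
      · simp [State.reg_setReg]
      · rw [State.reg_setReg, if_neg (by omega), State.reg_setArr, State.reg_setReg, if_neg hr,
          g4 r hr']
    · simpa [regBound] using hn'
    · rw [if_neg (by tauto)] at hsucc
      refine hτ.trans (fun a ha => ?_) ?_ ?_ (fun r hr hr' => ?_)
      · rw [State.arr_setReg, State.arr_setReg, g1]
      · rw [State.arr_setReg, State.arr_setReg, g1, hτ.tab, hsucc]
      · simp [State.reg_setReg]
      · rw [State.reg_setReg, if_neg (by omega), State.reg_setReg, if_neg hr, g4 r hr']
  · have h1 : (Expr.reg yR / Expr.reg stateR).cost = 3 := rfl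
    have h2 : (Expr.reg yR % Expr.reg stateR).cost = 3 := rfl
    rw [h1, h2]
    omega

/-- A bound for the time that `tabProgram` takes. -/
def tabTime (w : ℕ) : ℕ := 2048 * (stateNum w * stateNum w) * (profNum w * profNum w)

theorem wp_tab (hR : Room (wordBound w) Y W) {j B : ℕ} {f g : ℕ → ℕ} (hj : j < w)
    (hσ : TabReady w j B f g σ) (hB : 2 * B ≤ wordBound w * Y)
    (h0 : ∀ c, σ.reg newR ≤ c → σ.arr tabA c = 0) :
    WP (wordBound w) Y W tabProgram (tabTime w) (TabStep w f g (stateNum w * stateNum w) σ) σ := by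
  refine WP.time (WP.seq (WP.assign hR rfl (by simp) (WP.for hR rfl
    (m := 1024 * (profNum w * profNum w) + 128) (a := 0) (b := stateNum w * stateNum w)
    (fun n τ => TabStep w f g n σ τ) (Nat.zero_le _) ?_ ?_ ?_))) ?_
  · refine ⟨fun a ha => rfl, ?_, by simp [State.reg_setReg], fun r hr hr' => ?_⟩
    · funext c
      rw [State.arr_setReg, place]
      split_ifs with h
      · rw [h0 c h.1]
        rfl
      · rfl
    · rw [State.reg_setReg, if_neg (by omega)]
  · intro n τ _ hn hτ
    refine ⟨?_, wp_tabBody hR hj hσ hB hn hτ⟩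
    simp [hτ.y, hτ.reg stateR (by decide) (by decide), hσ.state, hn]
  · intro τ hτ
    refine ⟨?_, hτ⟩
    simp [hτ.y, hτ.reg stateR (by decide) (by decide), hσ.state]
  · have h1 : (Expr.lt (.reg yR) (.reg stateR * .reg stateR)).cost = 5 := rfl
    have h2 : (0 : Expr).cost = 1 := rfl
    rw [h1, h2, tabTime, Nat.sub_zero]
    have hP : 256 ≤ profNum w * profNum w := by
      have : 16 ≤ profNum w := by
        rw [profNum, pow_add]
        exact Nat.le_mul_of_pos_left _ (by positivity)
      nlinarith
    have hS : 1 ≤ stateNum w * stateNum w := Nat.mul_pos (one_lt_stateNum w).le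
        (one_lt_stateNum w).le
    generalize profNum w * profNum w = p at *
    generalize stateNum w * stateNum w = s at *
    have : s * 256 ≤ s * p := Nat.mul_le_mul_left _ hP
    nlinarith

end

section
variable {w Y W : ℕ} {σ : State}

/-! ### Processing the nodes -/

open Program in
/-- Read the current node and set the parameters of `tabProgram`, except for the left table. -/
def nodeHeader : Program :=
  seq (assign kindR (.get inA (3 * .reg nodeR + 3)))
  (seq (assign aR (.get powA (4 * .get inA (3 * .reg nodeR + 4) + 4)))
  (seq (assign bR (.get powA (4 * .get inA (3 * .reg nodeR + 5) + 4)))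
  (seq (assign rightR (.reg nodeR * .reg stateR))
  (assign newR (.reg nodeR * .reg stateR + .reg stateR)))))

open Program in
/-- Write the table of an introduce node. Array `3` stores for every node the number of the last
node in front of its subtree; for an introduce node this is the preceding node. -/
def introProgram : Program :=
  seq (store tabA (.reg newR + (.get powA (.reg aR + 1) ||| .get powA (2 * .reg aR + 2))) 2)
  (seq (store tabA (.reg newR + (.get powA (4 * .reg aR + 1) ||| .get powA (8 * .reg aR + 2))) 1)
  (store prevA (.reg nodeR + 1) (.reg nodeR)))

open Program in
/-- Write the table of an inner node. In post-order the right or only child is the preceding node,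
and the left child of a union node is the last node in front of the subtree of the right child. For
all other nodes the table of the empty graph, with number `0`, serves as the left table. -/
def innerProgram : Program :=
  seq (ite (Expr.eq (.reg kindR) 1)
    (seq (assign leftR (.get prevA (.reg nodeR) * .reg stateR))
      (store prevA (.reg nodeR + 1) (.get prevA (.get prevA (.reg nodeR)))))
    (seq (assign leftR 0) (store prevA (.reg nodeR + 1) (.get prevA (.reg nodeR)))))
  tabProgram

open Program in
/-- Process one node of the tree. -/
def nodeProgram : Program :=
  seq nodeHeader (seq (ite (.reg kindR) innerProgram introProgram) (assign nodeR (.reg nodeR + 1)))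

/-- The state after `m` nodes of the input `inp` have been processed. Nodes are numbered from `1`,
and the table of node `m` starts at the address `m * stateNum w` of array `2`; table `0` is that of
the empty graph. -/
structure Inv (w : ℕ) (inp : ℕ → ℕ) (m : ℕ) (σ : State) : Prop extends Ready w σ where
  node : σ.reg nodeR = m
  inp : σ.arr inA = inp
  fresh : ∀ c, (m + 1) * stateNum w ≤ c → σ.arr tabA c = 0
  empty : ∀ s < stateNum w, σ.arr tabA s = emptyTab s
  prev_le : ∀ i, σ.arr prevA i ≤ m

/-- The state `τ` arises from `σ` by processing the node after node `m`, which has the table `f` and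
for which array `3` gets the entry `p`. -/
structure NodeStep (w : ℕ) (inp : ℕ → ℕ) (m p : ℕ) (f : ℕ → ℕ) (σ τ : State) : Prop extends
    Inv w inp (m + 1) τ where
  prev : τ.arr prevA = Function.update (σ.arr prevA) (m + 1) p
  tab : τ.arr tabA = place (σ.arr tabA) ((m + 1) * stateNum w) (stateNum w) f

theorem NodeStep.of_eq {inp : ℕ → ℕ} {m p : ℕ} {f : ℕ → ℕ} {τ : State} (h : Inv w inp m σ)
    (hp : p ≤ m)
    (h1 : τ.reg profR = σ.reg profR) (h2 : τ.reg stateR = σ.reg stateR) (h3 : τ.reg nodeR = m + 1)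
    (h4 : τ.arr inA = σ.arr inA) (h5 : τ.arr powA = σ.arr powA)
    (h6 : τ.arr prevA = Function.update (σ.arr prevA) (m + 1) p)
    (h7 : τ.arr tabA = place (σ.arr tabA) ((m + 1) * stateNum w) (stateNum w) f) :
    NodeStep w inp m p f σ τ where
  prof := h1.trans h.prof
  state := h2.trans h.state
  pow x hx := by rw [h5, h.pow x hx]
  node := h3
  inp := h4.trans h.inp
  fresh c hc := by
    rw [add_one_mul] at hc
    rw [h7, place_of_le hc, h.fresh c (by omega)]
  empty s hs := by
    have : stateNum w ≤ (m + 1) * stateNum w := Nat.le_mul_of_pos_left _ (by omega)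
    rw [h7, place_of_lt (by omega), h.empty s hs]
  prev_le i := by
    rw [h6, Function.update_apply]
    split_ifs
    · omega
    · exact (h.prev_le i).trans (by omega)
  prev := h6
  tab := h7

/-- The state `ρ` arises from `σ` by `nodeHeader`, for a node of kind `k` with labels
`i` and `j`. -/
structure Header (w : ℕ) (m k i j : ℕ) (σ ρ : State) : Prop where
  arr : ρ.arr = σ.arr
  prof : ρ.reg profR = σ.reg profR
  state : ρ.reg stateR = σ.reg stateR
  node : ρ.reg nodeR = m
  kind : ρ.reg kindR = k
  a : ρ.reg aR = slot i
  b : ρ.reg bR = slot j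
  right : ρ.reg rightR = m * stateNum w
  new : ρ.reg newR = (m + 1) * stateNum w

theorem slot_le_wordBound {i : ℕ} (hi : i < w) : slot i ≤ wordBound w := by
  have := slot_mul_le hi
  have := (profNum_lt_stateNum w).le.trans (stateNum_le_wordBound w)
  omega

theorem exponent_le {i : ℕ} (hi : i < w) : 4 * i + 4 ≤ profNum w := by
  have : 4 * w + 4 < profNum w := Nat.lt_two_pow_self
  omega

theorem four_mul_stateNum_le (w : ℕ) : 4 * stateNum w ≤ wordBound w := by
  have : 16 ≤ profNum w := by
    rw [profNum, pow_add]
    exact Nat.le_mul_of_pos_left _ (by positivity)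
  have := profNum_lt_stateNum w
  exact (Nat.mul_le_mul_right _ (by omega)).trans (sq_stateNum_le w)

theorem table_bound (hY : 1 ≤ Y) {m : ℕ} (hm : m ≤ 2 * Y) :
    (m + 1) * stateNum w ≤ wordBound w * Y := by
  calc (m + 1) * stateNum w ≤ (4 * Y) * stateNum w := Nat.mul_le_mul_right _ (by omega)
    _ = 4 * stateNum w * Y := by ring
    _ ≤ _ := Nat.mul_le_mul_right _ (four_mul_stateNum_le w)

theorem wp_nodeHeader (hR : Room (wordBound w) Y W) {inp : ℕ → ℕ} {m : ℕ} (hσ : Inv w inp m σ)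
    (hm : m ≤ Y) (hk : inp (3 * m + 3) ≤ 4) (hi : inp (3 * m + 4) < w) (hj : inp (3 * m + 5) < w) :
    WP (wordBound w) Y W nodeHeader 100
      (Header w m (inp (3 * m + 3)) (inp (3 * m + 4)) (inp (3 * m + 5)) σ) σ := by
  have h4 : 4 ≤ wordBound w := by
    have := four_mul_stateNum_le w
    have := one_lt_stateNum w
    omega
  have hb := table_bound (w := w) hR.one_le (m := m) (by omega)
  have hb' : m * stateNum w ≤ wordBound w * Y := (Nat.mul_le_mul_right _ (by omega)).trans hb
  have hpi := hσ.pow _ (exponent_le hi)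
  have hpj := hσ.pow _ (exponent_le hj)
  have hsi := slot_le_wordBound hi
  have hsj := slot_le_wordBound hj
  have e : m * stateNum w + stateNum w = (m + 1) * stateNum w := by ring
  refine WP.time (WP.seq (WP.assign hR rfl ?_ (WP.seq (WP.assign hR rfl ?_
      (WP.seq (WP.assign hR rfl ?_
    (WP.seq (WP.assign hR rfl ?_ (WP.assign hR rfl ?_ ?_))))))))) (by decide)
  · simpa [regBound, hσ.node, hσ.inp] using hk.trans h4
  · simpa [regBound, hσ.node, hσ.inp, State.reg_setReg, State.arr_setReg, hpi, slot] using hsi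
  · simpa [regBound, hσ.node, hσ.inp, State.reg_setReg, State.arr_setReg, hpj, slot] using hsj
  · simpa [regBound, hσ.node, hσ.inp, State.reg_setReg, State.arr_setReg, hσ.state] using hb'
  · simpa [regBound, hσ.node, hσ.inp, State.reg_setReg, State.arr_setReg, hσ.state, e] using hb
  · constructor <;>
    simp [hσ.node, hσ.inp, State.reg_setReg, State.arr_setReg, hσ.state, hpi, hpj, slot, e]

theorem add_max_add_le {a m n b c : ℕ} (h : a + n + b ≤ c) : a + max m n + b ≤ m + c := by omega

/-- The table of an introduce node whose label has weight `a`. -/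
def introTab (a s : ℕ) : ℕ :=
  if s = 2 ^ mark a false true ||| 2 ^ mark a false false then 1
  else if s = 2 ^ mark a true true ||| 2 ^ mark a true false then 2 else 0

theorem wp_intro (hR : Room (wordBound w) Y W) {inp : ℕ → ℕ} {m : ℕ} (hσ : Inv w inp m σ)
    (hm : m ≤ Y) (hk : inp (3 * m + 3) = 0) (hi : inp (3 * m + 4) < w) (hj : inp (3 * m + 5) < w) :
    WP (wordBound w) Y W nodeProgram (tabTime w + 1024)
      (NodeStep w inp m m (introTab (slot (inp (3 * m + 4)))) σ) σ := by
  have hY := hR.one_le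
  have h16 := hR.sixteen_le
  have hMY : wordBound w ≤ wordBound w * Y := Nat.le_mul_of_pos_right _ hY
  have hmY : m + 1 ≤ wordBound w * Y := by nlinarith
  have hm1 := mark_lt hi true true
  have hm2 := mark_lt hi true false
  have hm3 := mark_lt hi false true
  have hm4 := mark_lt hi false false
  have hu1 : 2 ^ mark (slot (inp (3 * m + 4))) true true |||
      2 ^ mark (slot (inp (3 * m + 4))) true false < stateNum w :=
    st_lt (.intro ⟨_, hi⟩) fun _ => true
  have hu2 : 2 ^ mark (slot (inp (3 * m + 4))) false true |||
      2 ^ mark (slot (inp (3 * m + 4))) false false < stateNum w :=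
    st_lt (.intro ⟨_, hi⟩) fun _ => false
  have hp : ∀ c x, σ.arr powA (mark (slot (inp (3 * m + 4))) c x) =
      2 ^ mark (slot (inp (3 * m + 4))) c x := fun c x => hσ.pow _ (mark_lt hi c x).le
  have hp1 := hp true true
  have hp2 := hp true false
  have hp3 := hp false true
  have hp4 := hp false false
  -- The entry for the cheaper choice is written last, so the order matters if the states agree.
  have hplace : Function.update (Function.update (σ.arr tabA) ((m + 1) * stateNum w +
      (2 ^ mark (slot (inp (3 * m + 4))) true true |||
        2 ^ mark (slot (inp (3 * m + 4))) true false)) 2)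
      ((m + 1) * stateNum w + (2 ^ mark (slot (inp (3 * m + 4))) false true |||
        2 ^ mark (slot (inp (3 * m + 4))) false false)) 1 =
      place (σ.arr tabA) ((m + 1) * stateNum w) (stateNum w)
        (introTab (slot (inp (3 * m + 4)))) := by
    have : σ.arr tabA = place (σ.arr tabA) ((m + 1) * stateNum w) (stateNum w) fun _ => 0 := by
      funext c
      rw [place]
      split_ifs with h
      · exact hσ.fresh c h.1
      · rfl
    conv_lhs => rw [this]
    rw [update_place hu1, update_place hu2]
    congr 1
    funext s
    simp only [Function.update_apply, introTab]
  simp only [mark] at hp1 hp2 hp3 hp4 hplace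
  refine WP.time (WP.seq (n := tabTime w + 900) ((wp_nodeHeader hR hσ hm (by omega) hi hj).mono
    (fun ρ hρ => ?_) le_rfl)) (by omega)
  refine WP.time (WP.seq (WP.ite hR rfl (m := tabTime w) (fun h => absurd (hρ.kind.trans hk) h)
      (fun _ =>
    WP.seq (WP.store hR rfl rfl ?_ (WP.seq (WP.store hR rfl rfl ?_ (WP.store hR rfl rfl ?_
      (WP.assign hR rfl ?_ ?_)))))))) ?_
  · simp [arrBound]
    omega
  · simp [arrBound]
    omega
  · simp [arrBound, State.reg_setArr, hρ.node]
    omega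
  · simp [regBound, State.reg_setArr, hρ.node]
    omega
  · refine NodeStep.of_eq hσ le_rfl ?_ ?_ ?_ ?_ ?_ ?_ ?_ <;>
    simp [State.reg_setReg, State.arr_setReg, State.reg_setArr, State.arr_setArr, hρ.prof, hρ.state,
      hρ.node, hρ.arr, hρ.a, hρ.new, hp1, hp2, hp3, hp4]
    rw [← hplace]
  · exact add_max_add_le (by decide)
/-- The number of the left table for the node after node `m`, if that is an inner node of
kind `k`. -/
def leftOf (k : ℕ) (σ : State) (m : ℕ) : ℕ := if k = 1 then σ.arr prevA m else 0

/-- The entry of array `3` for the node after node `m`, if that is an inner node of kind `k`. -/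
def nextPrev (k : ℕ) (σ : State) (m : ℕ) : ℕ :=
  if k = 1 then σ.arr prevA (σ.arr prevA m) else σ.arr prevA m

/-- The table of node `m`. -/
def tabAt (w : ℕ) (σ : State) (m s : ℕ) : ℕ := σ.arr tabA (m * stateNum w + s)

theorem wp_inner (hR : Room (wordBound w) Y W) {inp : ℕ → ℕ} {m B : ℕ} (hσ : Inv w inp m σ)
    (hm : m ≤ Y) (hk : inp (3 * m + 3) ≤ 4) (hk0 : inp (3 * m + 3) ≠ 0)
    (hi : inp (3 * m + 4) < w) (hj : inp (3 * m + 5) < w)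
    (hl : ∀ s < stateNum w, tabAt w σ (leftOf (inp (3 * m + 3)) σ m) s ≤ B)
    (hr : ∀ s < stateNum w, tabAt w σ m s ≤ B) (hB : 2 * B ≤ wordBound w * Y) :
    WP (wordBound w) Y W nodeProgram (tabTime w + 1024)
      (NodeStep w inp m (nextPrev (inp (3 * m + 3)) σ m)
        (tabUpTo (profNum w) (stateNum w) (inp (3 * m + 3)) (slot (inp (3 * m + 4)))
          (slot (inp (3 * m + 5))) (tabAt w σ (leftOf (inp (3 * m + 3)) σ m)) (tabAt w σ m)
          (stateNum w * stateNum w)) σ) σ := by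
  have hY := hR.one_le
  have h16 := hR.sixteen_le
  have hMY : wordBound w ≤ wordBound w * Y := Nat.le_mul_of_pos_right _ hY
  have hmY : m + 1 ≤ wordBound w * Y := by nlinarith
  have hp := hσ.prev_le
  have hb := table_bound (w := w) hR.one_le (m := m) (by omega)
  have hlm : leftOf (inp (3 * m + 3)) σ m ≤ m := by
    unfold leftOf; split_ifs
    · exact hp m
    · omega
  have hlb : leftOf (inp (3 * m + 3)) σ m * stateNum w ≤ wordBound w * Y :=
    (Nat.mul_le_mul_right _ (by omega)).trans hb
  have hnp : nextPrev (inp (3 * m + 3)) σ m ≤ m := by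
    unfold nextPrev; split_ifs <;> exact hp _
  refine WP.time (WP.seq (n := tabTime w + 900) ((wp_nodeHeader hR hσ hm hk hi hj).mono
    (fun ρ hρ => ?_) le_rfl)) (by omega)
  let Mid : State → Prop := fun τ =>
    τ.reg leftR = leftOf (inp (3 * m + 3)) σ m * stateNum w ∧
    (∀ r, r ≠ leftR → τ.reg r = ρ.reg r) ∧ τ.arr inA = σ.arr inA ∧ τ.arr powA = σ.arr powA ∧
    τ.arr tabA = σ.arr tabA ∧
    τ.arr prevA = Function.update (σ.arr prevA) (m + 1) (nextPrev (inp (3 * m + 3)) σ m)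
  have hmid : ∀ τ, Mid τ → WP (wordBound w) Y W tabProgram (tabTime w)
      (WP (wordBound w) Y W (.assign nodeR (.reg nodeR + 1)) 10
      (NodeStep w inp m (nextPrev (inp (3 * m + 3)) σ m)
        (tabUpTo (profNum w) (stateNum w) (inp (3 * m + 3)) (slot (inp (3 * m + 4)))
          (slot (inp (3 * m + 5))) (tabAt w σ (leftOf (inp (3 * m + 3)) σ m)) (tabAt w σ m)
          (stateNum w * stateNum w)) σ)) τ := by
    rintro τ ⟨t1, t2, t3, t4, t5, t6⟩
    have tn : τ.reg newR = (m + 1) * stateNum w := (t2 _ (by decide)).trans hρ.new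
    have tr : τ.reg rightR = m * stateNum w := (t2 _ (by decide)).trans hρ.right
    have tp : τ.reg profR = σ.reg profR := (t2 _ (by decide)).trans hρ.prof
    have ts : τ.reg stateR = σ.reg stateR := (t2 _ (by decide)).trans hρ.state
    have tk : τ.reg kindR = inp (3 * m + 3) := (t2 _ (by decide)).trans hρ.kind
    have ta : τ.reg aR = slot (inp (3 * m + 4)) := (t2 _ (by decide)).trans hρ.a
    have tb : τ.reg bR = slot (inp (3 * m + 5)) := (t2 _ (by decide)).trans hρ.b
    have tm : τ.reg nodeR = m := (t2 _ (by decide)).trans hρ.node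
    have hready : TabReady w (inp (3 * m + 5)) B (tabAt w σ (leftOf (inp (3 * m + 3)) σ m))
        (tabAt w σ m) τ :=
      { prof := tp.trans hσ.prof
        state := ts.trans hσ.state
        pow := fun x hx => by rw [t4, hσ.pow x hx]
        hb := tb
        left := fun s _ => by rw [t5, t1]; rfl
        right := fun s _ => by rw [t5, tr]; rfl
        left_le := hl
        right_le := hr
        left_lt := by
          rw [t1, tn, add_one_mul]
          exact Nat.add_le_add_right (Nat.mul_le_mul_right _ hlm) _
        right_lt := by rw [tr, tn, add_one_mul] }
    refine (wp_tab hR hj hready hB ?_).mono (fun θ hθ => ?_) le_rfl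
    · intro c hc
      rw [t5]
      exact hσ.fresh c (by omega)
    · have hθm : θ.reg nodeR = m := (hθ.reg _ (by decide) (by decide)).trans tm
      refine WP.time (WP.assign hR rfl ?_ ?_) (by decide)
      · simpa [regBound, hθm] using hmY
      · refine NodeStep.of_eq hσ hnp ?_ ?_ ?_ ?_ ?_ ?_ ?_
        · simpa [State.reg_setReg] using (hθ.reg _ (by decide) (by decide)).trans tp
        · simpa [State.reg_setReg] using (hθ.reg _ (by decide) (by decide)).trans ts
        · simp [State.reg_setReg, hθm]
        · exact (hθ.arr _ (by decide)).trans t3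
        · exact (hθ.arr _ (by decide)).trans t4
        · exact (hθ.arr _ (by decide)).trans t6
        · rw [State.arr_setReg, hθ.tab, tabOf, t5, tn, tk, ta, tb]
  have hbr : ∀ {Q : State → Prop}, (∀ τ, Mid τ → WP (wordBound w) Y W tabProgram (tabTime w) Q τ) →
      WP (wordBound w) Y W innerProgram (100 + tabTime w) Q ρ := by
    intro Q hQ
    refine WP.seq (WP.mono (R := Mid) (m := 100) ?_ hQ le_rfl)
    refine WP.time (WP.ite hR rfl
      (fun h => WP.seq (WP.assign hR rfl ?_ (WP.store hR rfl rfl ?_ ?_)))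
      (fun h => WP.seq (WP.assign hR rfl ?_ (WP.store hR rfl rfl ?_ ?_)))) (by decide)
    all_goals
      simp [hρ.kind] at h
      simp only [leftOf, nextPrev, h, if_true, if_false] at hlb hnp
    · simpa [regBound, hρ.node, hρ.arr, hρ.state, hσ.state] using hlb
    · simp [arrBound, State.reg_setReg, State.arr_setReg, hρ.node, hρ.arr]
      omega
    · refine ⟨?_, fun r hr => ?_, ?_, ?_, ?_, ?_⟩ <;>
      simp [State.reg_setReg, State.arr_setReg, State.reg_setArr, State.arr_setArr, hρ.node, hρ.arr,
        hρ.state, hσ.state, leftOf, nextPrev, h]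
      intro; contradiction
    · simp [regBound]
    · simp [arrBound, State.reg_setReg, State.arr_setReg, hρ.node, hρ.arr]
      omega
    · refine ⟨?_, fun r hr => ?_, ?_, ?_, ?_, ?_⟩ <;>
      simp [State.reg_setReg, State.arr_setReg, State.reg_setArr, State.arr_setArr, hρ.node, hρ.arr,
        leftOf, nextPrev, h]
      intro; contradiction
  have hkρ : (Expr.reg kindR).eval ρ ≠ 0 := by simpa [hρ.kind] using hk0
  refine WP.time (WP.seq (WP.ite hR rfl (n := 0) (fun _ => hbr hmid) (fun h => absurd h hkρ))) ?_
  have hc : (Expr.reg kindR).cost = 1 := rfl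
  rw [hc]
  omega

/-- Process all nodes of the tree, and one node of kind `4` after them. -/
def treeLoop : Program := .loop (Expr.lt (.reg nodeR) (.get inA 2 + 1)) nodeProgram

/-- A bound for the time of one iteration of `treeLoop`. -/
def stepTime (w : ℕ) : ℕ := tabTime w + 2048

/-- One iteration -/
theorem wp_treeLoop_step (hR : Room (wordBound w) Y W) {inp : ℕ → ℕ} {m n : ℕ} (hσ : Inv w inp m σ)
    (hm : m ≤ inp 2) {R Q : State → Prop}
    (h : WP (wordBound w) Y W nodeProgram (tabTime w + 1024) R σ)
    (hQ : ∀ τ, R τ → WP (wordBound w) Y W treeLoop n Q τ) :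
    WP (wordBound w) Y W treeLoop (n + stepTime w) Q σ := by
  refine WP.time (WP.loop_true hR rfl ?_ (h.mono hQ le_rfl)) ?_
  · simp [hσ.node, hσ.inp]
    omega
  · have hc : (Expr.lt (.reg nodeR) (.get inA 2 + 1)).cost = 6 := rfl
    rw [hc, stepTime]
    omega

/-! ### Processing a subtree -/

/-- The state `τ` arises from `σ` by processing the nodes of `T`, which follow node `m`. -/
structure Processed (T : CWExpr w) (inp : ℕ → ℕ) (m : ℕ) (σ τ : State) : Prop extends
    Inv w inp (m + T.numNodes) τ where
  table : IsTable T (tabAt w τ (m + T.numNodes))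
  prev : τ.arr prevA (m + T.numNodes) = m
  prev_old : ∀ i ≤ m, τ.arr prevA i = σ.arr prevA i
  tab_old : ∀ c < (m + 1) * stateNum w, τ.arr tabA c = σ.arr tabA c

theorem length_code (T : CWExpr w) : T.code.length = 3 * T.numNodes := by
  induction T with
  | intro i => rfl
  | union s t hs ht => simp only [code, numNodes, List.length_append, hs, ht]; simp; ring
  | relabel i j t ht => simp only [code, numNodes, List.length_append, ht]; simp; ring
  | join i j t ht => simp only [code, numNodes, List.length_append, ht]; simp; ring

/-- The words of `l` stand in the input from the node after node `m` on. -/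
def Reads (inp : ℕ → ℕ) (m : ℕ) (l : List ℕ) : Prop :=
  ∀ x (h : x < l.length), inp (3 * m + 3 + x) = l[x]

theorem Reads.left {inp : ℕ → ℕ} {m : ℕ} {l l' : List ℕ} (h : Reads inp m (l ++ l')) :
    Reads inp m l :=
  fun x hx => by
    rw [h x (by rw [List.length_append]; omega), List.getElem_append_left hx]

theorem Reads.right {inp : ℕ → ℕ} {m n : ℕ} {l l' : List ℕ} (h : Reads inp m (l ++ l'))
    (hl : l.length = 3 * n) : Reads inp (m + n) l' := fun x hx => by
  have := h (l.length + x) (by rw [List.length_append]; omega)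
  rw [List.getElem_append_right (by omega)] at this
  simp only [Nat.add_sub_cancel_left] at this
  rw [← this, hl]
  congr 1
  ring

theorem tabAt_place {τ : State} {f g : ℕ → ℕ} {m s : ℕ}
    (h : τ.arr tabA = place f (m * stateNum w) (stateNum w) g)
    (hs : s < stateNum w) : tabAt w τ m s = g s := by
  rw [tabAt, h, place_add hs]

theorem tabAt_congr {τ : State} {m n s : ℕ}
    (h : ∀ c < (n + 1) * stateNum w, τ.arr tabA c = σ.arr tabA c)
    (hm : m ≤ n) (hs : s < stateNum w) : tabAt w τ m s = tabAt w σ m s := by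
  refine h _ ?_
  have : m * stateNum w ≤ n * stateNum w := Nat.mul_le_mul_right _ hm
  rw [add_one_mul]
  omega

theorem NodeStep.tab_old {inp : ℕ → ℕ} {m p : ℕ} {f : ℕ → ℕ} {τ : State}
    (h : NodeStep w inp m p f σ τ) :
    ∀ c < (m + 1) * stateNum w, τ.arr tabA c = σ.arr tabA c := fun c hc => by
  rw [h.tab, place_of_lt hc]

theorem _root_.IsTable.congr {T : CWExpr w} {f g : ℕ → ℕ} (hf : IsTable T f)
    (h : ∀ s < stateNum w, g s = f s) : IsTable T g := fun s hs c => by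
  rw [AtMost, h s hs]
  exact hf s hs c

theorem two_mul_succ_le_wordBound_mul (hR : Room (wordBound w) Y W) {N : ℕ} (hN : N ≤ Y) :
    2 * (N + 1) ≤ wordBound w * Y := by
  have := hR.sixteen_le
  have := hR.one_le
  nlinarith

/-- Nodes with one child, including the additional node of kind `4`. -/
theorem wp_unary_node (hR : Room (wordBound w) Y W) {inp : ℕ → ℕ} (hN : inp 2 ≤ Y) {T : CWExpr w}
    {k i j m : ℕ} (hk : 1 < k) (hk' : k ≤ 4) (hi : i < w) (hj : j < w) (hσ : Inv w inp m σ)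
    (hT : IsTable T (tabAt w σ m)) (hTN : T.numNodes ≤ inp 2) (hm : m ≤ inp 2)
    (r0 : inp (3 * m + 3) = k) (r1 : inp (3 * m + 4) = i) (r2 : inp (3 * m + 5) = j) :
    WP (wordBound w) Y W nodeProgram (tabTime w + 1024)
      (NodeStep w inp m (σ.arr prevA m) (tabUpTo (profNum w) (stateNum w) k (slot i) (slot j)
          (tabAt w σ 0) (tabAt w σ m) (stateNum w * stateNum w)) σ) σ := by
  have hl : leftOf k σ m = 0 := if_neg (by omega)
  have hnp : nextPrev k σ m = σ.arr prevA m := if_neg (by omega)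
  have hstep := wp_inner (B := inp 2 + 1) hR hσ (by omega) (by omega) (by omega) (by omega)
      (by omega)
    (by
      rw [r0, hl]
      intro x hx
      rw [tabAt, zero_mul, zero_add, hσ.empty x hx, emptyTab]
      split_ifs <;> omega)
    (by intro x hx; have := hT.le hx; omega) (two_mul_succ_le_wordBound_mul hR hN)
  rwa [r0, r1, r2, hl, hnp] at hstep

theorem Inv.tabAt_zero {inp : ℕ → ℕ} {m : ℕ} (hσ : Inv w inp m σ) :
    ∀ s < stateNum w, tabAt w σ 0 s = emptyTab s := fun s hs => by
  rw [tabAt, zero_mul, zero_add, hσ.empty s hs]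

theorem wp_unary (hR : Room (wordBound w) Y W) {inp : ℕ → ℕ} {Q : State → Prop} (hN : inp 2 ≤ Y)
    {T T' : CWExpr w} {k i j m n : ℕ} {τ : State} (hk : 1 < k) (hk' : k ≤ 4) (hi : i < w)
      (hj : j < w)
    (hT' : T'.numNodes = T.numNodes + 1)
    (htab : ∀ f g, IsTable T g → (∀ s < stateNum w, f s = emptyTab s) →
      IsTable T' (tabUpTo (profNum w) (stateNum w) k (slot i) (slot j) f g
        (stateNum w * stateNum w)))
    (h : Processed T inp m σ τ) (hm : m + T.numNodes ≤ inp 2)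
    (r0 : inp (3 * (m + T.numNodes) + 3) = k) (r1 : inp (3 * (m + T.numNodes) + 4) = i)
    (r2 : inp (3 * (m + T.numNodes) + 5) = j)
    (hQ : ∀ ρ, Processed T' inp m σ ρ → WP (wordBound w) Y W treeLoop n Q ρ) :
    WP (wordBound w) Y W treeLoop (n + stepTime w) Q τ := by
  refine wp_treeLoop_step hR h.toInv (by omega) (wp_unary_node hR hN hk hk' hi hj h.toInv h.table
    (by omega) (by omega) r0 r1 r2) fun ρ hρ => hQ ρ ?_
  rw [h.prev] at hρ
  have e : m + T'.numNodes = m + T.numNodes + 1 := by rw [hT']; rfl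
  exact
    { toInv := by rw [e]; exact hρ.toInv
      table := by
        rw [e]
        exact (htab _ _ h.table h.toInv.tabAt_zero).congr fun x hx => tabAt_place hρ.tab hx
      prev := by rw [e, hρ.prev]; exact Function.update_self ..
      prev_old := fun x hx => by rw [hρ.prev, Function.update_of_ne (by omega), h.prev_old x hx]
      tab_old := fun c hc => by
        have : (m + 1) * stateNum w ≤ (m + T.numNodes + 1) * stateNum w :=
          Nat.mul_le_mul_right _ (by omega)
        rw [hρ.tab_old c (by omega), h.tab_old c hc] }

/-- The loop processes the nodes of `T` and continues with whatever follows them. Stating this with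
a continuation makes it compose at union nodes. -/
theorem wp_tree (hR : Room (wordBound w) Y W) {inp : ℕ → ℕ} {Q : State → Prop} (hN : inp 2 ≤ Y)
    (T : CWExpr w) : ∀ (m n : ℕ) (σ : State), Inv w inp m σ → m + T.numNodes ≤ inp 2 →
    Reads inp m T.code → (∀ τ, Processed T inp m σ τ → WP (wordBound w) Y W treeLoop n Q τ) →
    WP (wordBound w) Y W treeLoop (n + T.numNodes * stepTime w) Q σ := by
  have hB := two_mul_succ_le_wordBound_mul hR hN
  induction T with
  | intro i =>
    intro m n σ hσ hm hread hQ
    simp only [numNodes, one_mul] at hm ⊢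
    have h0 : inp (3 * m + 3) = 0 := hread 0 (by simp [code])
    have h1 : inp (3 * m + 4) = i := hread 1 (by simp [code])
    have h2 : inp (3 * m + 5) = 0 := hread 2 (by simp [code])
    refine wp_treeLoop_step hR hσ (by omega) (wp_intro hR hσ (by omega) h0 (by rw [h1]; exact i.2)
      (by rw [h2]; exact i.pos)) fun τ hτ => hQ τ ?_
    exact
      { toInv := hτ.toInv
        table := (isTable_intro i (f := introTab (slot i)) fun _ _ => rfl).congr fun s hs => by
          rw [← h1]; exact tabAt_place hτ.tab hs
        prev := by rw [hτ.prev]; exact Function.update_self ..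
        prev_old := fun x hx => by rw [hτ.prev, Function.update_of_ne (by omega)]
        tab_old := hτ.tab_old }
  | union s t hs ht =>
    intro m n σ hσ hm hread hQ
    simp only [numNodes] at hm ⊢
    rw [code] at hread
    have r1 := hread.left.left
    have r2 := hread.left.right (length_code s)
    have r3 := hread.right (n := s.numNodes + t.numNodes)
      (by rw [List.length_append, length_code, length_code]; ring)
    rw [← add_assoc] at r3
    refine WP.time (hs m (n + stepTime w + t.numNodes * stepTime w) σ hσ (by omega) r1 fun τ₁ h₁ =>
      ht (m + s.numNodes) (n + stepTime w) τ₁ h₁.toInv (by omega) r2 fun τ₂ h₂ => ?_)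
        (by ring_nf; rfl)
    have k0 : inp (3 * (m + s.numNodes + t.numNodes) + 3) = 1 := r3 0 (by simp)
    have k1 : inp (3 * (m + s.numNodes + t.numNodes) + 4) = 0 := r3 1 (by simp)
    have k2 : inp (3 * (m + s.numNodes + t.numNodes) + 5) = 0 := r3 2 (by simp)
    have hw := pos_of_expr s
    have hl : leftOf 1 τ₂ (m + s.numNodes + t.numNodes) = m + s.numNodes := by
      rw [leftOf, if_pos rfl, h₂.prev]
    have hnp : nextPrev 1 τ₂ (m + s.numNodes + t.numNodes) = m := by
      rw [nextPrev, if_pos rfl, h₂.prev, h₂.prev_old _ le_rfl, h₁.prev]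
    have hts : IsTable s (tabAt w τ₂ (m + s.numNodes)) :=
      h₁.table.congr fun x hx => tabAt_congr h₂.tab_old le_rfl hx
    have hstep := wp_inner (B := inp 2 + 1) hR h₂.toInv (by omega) (by omega) (by omega)
        (by omega) (by omega)
      (by rw [k0, hl]; intro x hx; have := hts.le hx; omega)
      (by intro x hx; have := h₂.table.le hx; omega) hB
    rw [k0, k1, k2, hl, hnp] at hstep
    refine wp_treeLoop_step hR h₂.toInv (by omega) hstep fun τ hτ => hQ τ ?_
    have e : m + (s.numNodes + t.numNodes + 1) = m + s.numNodes + t.numNodes + 1 := by ring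
    exact
      { toInv := by rw [numNodes, e]; exact hτ.toInv
        table := by
          rw [numNodes, e]
          exact (isTable_union s t hts h₂.table).congr fun x hx => tabAt_place hτ.tab hx
        prev := by
          rw [numNodes, e, hτ.prev]; exact Function.update_self ..
        prev_old := fun x hx => by
          rw [hτ.prev, Function.update_of_ne (by omega), h₂.prev_old x (by omega), h₁.prev_old x hx]
        tab_old := fun c hc => by
          have h1 : (m + 1) * stateNum w ≤ (m + s.numNodes + 1) * stateNum w :=
            Nat.mul_le_mul_right _ (by omega)
          have h2 : (m + 1) * stateNum w ≤ (m + s.numNodes + t.numNodes + 1) * stateNum w :=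
            Nat.mul_le_mul_right _ (by omega)
          rw [hτ.tab_old c (by omega), h₂.tab_old c (by omega), h₁.tab_old c hc] }
  | relabel i j t ht =>
    intro m n σ hσ hm hread hQ
    simp only [numNodes] at hm ⊢
    rw [code] at hread
    have r := hread.right (length_code t)
    refine WP.time (ht m (n + stepTime w) σ hσ (by omega) hread.left fun τ hτ =>
      wp_unary hR hN (T' := .relabel i j t) (k := 2) (by omega) (by omega) i.2 j.2 rfl
        (fun f g hg hf => isTable_relabel t i j hg hf) hτ (by omega) (r 0 (by simp)) (r 1 (by simp))
        (r 2 (by simp)) hQ) (by ring_nf; rfl)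
  | join i j t ht =>
    intro m n σ hσ hm hread hQ
    simp only [numNodes] at hm ⊢
    rw [code] at hread
    have r := hread.right (length_code t)
    refine WP.time (ht m (n + stepTime w) σ hσ (by omega) hread.left fun τ hτ =>
      wp_unary hR hN (T' := .join i j t) (k := 3) (by omega) (by omega) i.2 j.2 rfl
        (fun f g hg hf => isTable_join t i j hg hf) hτ (by omega) (r 0 (by simp)) (r 1 (by simp))
        (r 2 (by simp)) hQ) (by ring_nf; rfl)

end

section
variable {w Y W : ℕ} {σ : State}

/-- The additional node of kind `4` turns the table of the whole tree into the answer. -/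
theorem wp_treeLoop (hR : Room (wordBound w) Y W) {inp : ℕ → ℕ} (hN : inp 2 ≤ Y) (T : CWExpr w)
    (hσ : Inv w inp 0 σ) (hT : inp 2 = T.numNodes) (hread : Reads inp 0 T.code)
    (r0 : inp (3 * T.numNodes + 3) = 4) (r1 : inp (3 * T.numNodes + 4) = 0)
    (r2 : inp (3 * T.numNodes + 5) = 0) :
    WP (wordBound w) Y W treeLoop (7 + (T.numNodes + 1) * stepTime w) (fun τ =>
      Inv w inp (T.numNodes + 1) τ ∧ ∀ c, AtMost (tabAt w τ (T.numNodes + 1)) 0 c ↔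
        ∃ C, T.cost C ≤ c ∧ comb (profNum w) 4 (slot 0) (slot 0) 1 (T.st C) = 0) σ := by
  have hw := pos_of_expr T
  refine WP.time (wp_tree hR hN T 0 (7 + stepTime w) σ hσ (by omega) hread fun τ hτ => ?_)
    (by ring_nf; rfl)
  have hτ1 := hτ.toInv
  have hτ2 := hτ.table
  rw [zero_add] at hτ1 hτ2
  refine wp_treeLoop_step hR hτ1 (by omega) (wp_unary_node hR hN (k := 4) (by omega) (by omega)
    hw hw
    hτ1 hτ2 (by omega) (by omega) r0 r1 r2) fun ρ hρ => ?_
  refine WP.loop_false hR rfl ?_ ⟨hρ.toInv, fun c => ?_⟩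
  · simp [hρ.toInv.node, hρ.toInv.inp, hT]
  · have h0 : 0 < stateNum w := (one_lt_stateNum w).le
    rw [AtMost, tabAt_place hρ.tab h0]
    refine (atMost_tab_empty T hτ2 hτ1.tabAt_zero 4 (slot 0) (slot 0) 0 c).trans ?_
    exact exists_congr fun C => and_comm

/-! ### Initialization -/

open Program in
/-- Extend the list of powers of two in array `1` up to the index in register `21`. -/
def powLoop : Program :=
  loop (Expr.lt (.reg xR) (.reg limR))
    (seq (store powA (.reg xR + 1) (2 * .get powA (.reg xR))) (assign xR (.reg xR + 1)))

/-- The state `τ` arises from `σ` by extending the list of powers of two up to index `n`. -/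
structure PowStep (n : ℕ) (σ τ : State) : Prop where
  cnt : τ.reg xR = n
  reg : ∀ r, r ≠ xR → τ.reg r = σ.reg r
  arr : ∀ a, a ≠ powA → τ.arr a = σ.arr a
  pow : ∀ y ≤ n, τ.arr powA y = 2 ^ y

theorem wp_powLoop (hR : Room (wordBound w) Y W) {x l : ℕ} (hx : σ.reg xR = x) (hl : σ.reg limR = l)
    (hxl : x ≤ l) (hlP : l ≤ profNum w) (hpow : ∀ y ≤ x, σ.arr powA y = 2 ^ y) :
    WP (wordBound w) Y W powLoop (32 * (profNum w)) (PowStep l σ) σ := by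
  refine WP.time (WP.for hR rfl (m := 20) (a := x) (b := l) (fun x τ => PowStep x σ τ) hxl
    ⟨hx, fun _ _ => rfl, fun _ _ => rfl, hpow⟩ ?_ ?_) ?_
  · intro y τ _ hy hτ
    have hylim : y + 1 ≤ wordBound w :=
      (hy.trans_le hlP : y < profNum w).trans ((profNum_lt_stateNum w).trans_le
          (stateNum_le_wordBound w))
    have hyp : 2 * 2 ^ y ≤ wordBound w := by
      rw [← pow_succ']
      exact (Nat.pow_le_pow_right (by norm_num) (hy.trans_le hlP)).trans (stateNum_le_wordBound w)
    refine ⟨by simp [hτ.cnt, hτ.reg limR (by decide), hl, hy],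
      WP.time (WP.seq (WP.store hR rfl rfl ?_
      (WP.assign hR rfl ?_ ?_))) (by decide)⟩
    · simpa [arrBound, hτ.cnt, hτ.pow y le_rfl] using hyp
    · simpa [regBound, hτ.cnt, State.reg_setArr] using hylim
    · refine ⟨?_, fun r hr => ?_, fun a ha => ?_, fun z hz => ?_⟩
      · simp [State.reg_setReg, State.reg_setArr, hτ.cnt]
      · rw [State.reg_setReg, if_neg hr, State.reg_setArr, hτ.reg r hr]
      · rw [State.arr_setReg, State.arr_setArr, if_neg ha, hτ.arr a ha]
      · rw [State.arr_setReg, State.arr_setArr, if_pos rfl]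
        simp only [Expr.eval_add, Expr.eval_reg, Expr.eval_ofNat, Expr.eval_mul, Expr.eval_get,
          hτ.cnt,
          hτ.pow y le_rfl]
        rw [Function.update_apply]
        split_ifs with h
        · rw [h, pow_succ']
        · exact hτ.pow z (by omega)
  · intro τ hτ
    exact ⟨by simp [hτ.cnt, hτ.reg limR (by decide), hl], hτ⟩
  · have h1 : (Expr.lt (.reg xR) (.reg limR)).cost = 3 := rfl
    have := profNum_pos w
    rw [h1]
    omega

open Program in
/-- Compute `profNum w = 2 ^ (4 * w + 4)` and `stateNum w = 2 ^ profNum w`, write the table of the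
empty graph, and append a node of kind `4` to the input. -/
def setup : Program :=
  seq (store powA 0 1)
  (seq (assign limR (4 * .get inA 0 + 4))
  (seq powLoop
  (seq (assign limR (.get powA (.reg limR)))
  (seq powLoop
  (seq (assign profR (.reg limR))
  (seq (assign stateR (.get powA (.reg limR)))
  (seq (store tabA 1 1)
  (store inA (3 * .get inA 2 + 3) 4))))))))

theorem wp_setup (hR : Room (wordBound w) Y W) {inp : ℕ → ℕ} (hw : inp 0 = w)
    (hreg : ∀ r, σ.reg r = 0) (hin : σ.arr inA = inp) (harr : ∀ a, a ≠ inA → ∀ i, σ.arr a i = 0) :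
    WP (wordBound w) Y W setup (128 * profNum w)
      (Inv w (Function.update inp (3 * inp 2 + 3) 4) 0) σ := by
  have h16 := hR.sixteen_le
  have hMY : wordBound w ≤ wordBound w * Y := Nat.le_mul_of_pos_right _ hR.one_le
  have hP := profNum_lt_stateNum w
  have hS := stateNum_le_wordBound w
  have hlim : 4 * w + 4 ≤ profNum w := Nat.lt_two_pow_self.le
  -- The first call of `powLoop` provides `profNum w`, the second one `stateNum w`.
  refine WP.time (WP.seq (WP.store hR rfl rfl ?_ (WP.seq (WP.assign hR rfl ?_ (WP.seq
    ((wp_powLoop hR (x := 0) (l := 4 * w + 4) ?_ ?_ (Nat.zero_le _) hlim ?_).mono (fun τ hτ =>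
      (?_ : WP _ _ _ _ (100 + 32 * profNum w) _ τ)) le_rfl)))))) ?_
  · simp [arrBound]; omega
  · simp [regBound, State.arr_setArr, hin, hw]; omega
  · simp [State.reg_setReg, State.reg_setArr, hreg]
  · simp [State.reg_setReg, State.arr_setArr, hin, hw]
  · intro y hy
    obtain rfl : y = 0 := by omega
    simp [State.arr_setReg, State.arr_setArr]
  · have hl : τ.reg limR = 4 * w + 4 := by
      rw [hτ.reg _ (by decide)]
      simp [State.reg_setReg, State.arr_setArr, hin, hw]
    have hpl : τ.arr powA (4 * w + 4) = profNum w := hτ.pow _ le_rfl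
    have ht0 : τ.arr inA = inp := by
      rw [hτ.arr _ (by decide)]
      simp [State.arr_setReg, State.arr_setArr, hin]
    have ht2 : ∀ a, a ≠ inA → a ≠ powA → ∀ i, τ.arr a i = 0 := by
      intro a h0 h1 i
      rw [hτ.arr _ h1]
      simp [State.arr_setReg, State.arr_setArr, h1, harr a h0]
    have htn : τ.reg nodeR = 0 := by
      rw [hτ.reg _ (by decide)]
      simp [State.reg_setReg, State.reg_setArr, hreg]
    refine WP.time (WP.seq (WP.assign hR rfl ?_ (WP.seq ((wp_powLoop hR (x := 4 * w + 4)
      (l := profNum w) ?_ ?_ hlim le_rfl ?_).mono (fun ρ hρ => (?_ : WP _ _ _ _ 80 _ ρ))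
        le_rfl)))) ?_
    · simp [regBound, hl, hpl]; omega
    · simp [State.reg_setReg, hτ.cnt]
    · simp [State.reg_setReg, hl, hpl]
    · intro y hy
      rw [State.arr_setReg, hτ.pow y hy]
    · have hl' : ρ.reg limR = profNum w := by
        rw [hρ.reg _ (by decide)]
        simp [State.reg_setReg, hl, hpl]
      have hpl' : ρ.arr powA (profNum w) = stateNum w := hρ.pow _ le_rfl
      have hr0 : ρ.arr inA = inp := by rw [hρ.arr _ (by decide), State.arr_setReg, ht0]
      have hr2 : ∀ a, a ≠ inA → a ≠ powA → ∀ i, ρ.arr a i = 0 := fun a h0 h1 i => by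
        rw [hρ.arr _ h1, State.arr_setReg, ht2 a h0 h1 i]
      have hrn : ρ.reg nodeR = 0 := by
        rw [hρ.reg _ (by decide), State.reg_setReg, if_neg (by decide), htn]
      refine WP.time (WP.seq (WP.assign hR rfl ?_ (WP.seq (WP.assign hR rfl ?_ (WP.seq
        (WP.store hR rfl rfl ?_ (WP.store hR rfl rfl ?_ ?_))))))) (by decide)
      · simp [regBound, hl']; omega
      · simp [regBound, State.reg_setReg, State.arr_setReg, hl', hpl']; omega
      · simp [arrBound]; omega
      · simp [arrBound]; omega
      · constructor
        · constructor
          · simp [State.reg_setReg, State.reg_setArr, hl']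
          · simp [State.reg_setReg, State.reg_setArr, State.arr_setReg, hl', hpl']
          · intro y hy
            simp [State.arr_setReg, State.arr_setArr, hρ.pow y hy]
        · simp [State.reg_setReg, State.reg_setArr, hrn]
        · simp [State.arr_setReg, State.arr_setArr, hr0]
        · intro c hc
          have := one_lt_stateNum w
          simp [State.arr_setReg, State.arr_setArr]
          rw [Function.update_of_ne (by omega), hr2 _ (by decide) (by decide)]
        · intro s hs
          simp [State.arr_setReg, State.arr_setArr, emptyTab, Function.update_apply,
            hr2 tabA (by decide) (by decide)]
        · intro i
          simp [State.arr_setReg, State.arr_setArr, hr2 prevA (by decide) (by decide)]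
    · have : (Expr.get powA (.reg limR)).cost = 2 := rfl
      rw [this]
      omega
  · have h1 : (Expr.cost 0) = 1 := rfl
    have h1' : (Expr.cost 1) = 1 := rfl
    have h2 : (4 * .get inA 0 + 4 : Expr).cost = 6 := rfl
    have : 16 ≤ profNum w := by
      rw [profNum, pow_add]
      exact Nat.le_mul_of_pos_left _ (by positivity)
    rw [h1, h1', h2]
    omega

/-! ### The algorithm -/

open Program in
/-- The dynamic program for minimum cover spanning trees. The entry of
the additional node of kind `4` for the empty state is one more than the least size of a feasible
set, and is compared with `k + 1`. -/
def mcstProgram : Program :=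
  seq setup (seq treeLoop
    (assign ansR (Expr.lt 0 (.get tabA (.reg nodeR * .reg stateR)) *
      Expr.lt (.get tabA (.reg nodeR * .reg stateR)) (.get inA 1 + 2))))

theorem mem_code_le (T : CWExpr w) : ∀ x ∈ T.code, x ≤ w + 3 := by
  induction T with
  | intro i => simp [code]; omega
  | union s t hs ht =>
    simp only [code, List.mem_append]
    rintro x ((h | h) | h)
    · exact hs x h
    · exact ht x h
    · simp at h; omega
  | relabel i j t ht =>
    simp only [code, List.mem_append]
    rintro x (h | h)
    · exact ht x h
    · simp at h; omega
  | join i j t ht =>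
    simp only [code, List.mem_append]
    rintro x (h | h)
    · exact ht x h
    · simp at h; omega

theorem bounded_init (T : CWExpr w) (k : ℕ) :
    Bounded (wordBound w) (T.numNodes + k) (State.init (mcstInput T k)) := by
  have h16 := four_mul_stateNum_le w
  have hlim : 4 * w + 4 < profNum w := Nat.lt_two_pow_self
  have hP := profNum_lt_stateNum w
  have hN : 1 ≤ T.numNodes := by cases T <;> simp [numNodes]
  have hMY : wordBound w ≤ wordBound w * (T.numNodes + k) := Nat.le_mul_of_pos_right _ (by omega)
  have hYM : T.numNodes + k ≤ wordBound w * (T.numNodes + k) := Nat.le_mul_of_pos_left _ (by omega)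
  refine ⟨fun x => Nat.zero_le _, fun a i => ?_⟩
  by_cases ha : a = 0
  · subst ha
    simp only [State.init, if_true, arrBound]
    rw [if_neg (by decide)]
    rw [List.getD_eq_getElem?_getD]
    rcases h : (mcstInput T k)[i]? with _ | x
    · exact Nat.zero_le _
    · have hx := List.mem_of_getElem? h
      simp only [mcstInput, List.mem_append, List.mem_cons, List.not_mem_nil, or_false] at hx
      simp only [Option.getD_some]
      rcases hx with (hx | hx | hx) | hx
      · omega
      · omega
      · omega
      · have := mem_code_le T x hx
        omega
  · simp [State.init, ha]

theorem wp_mcstProgram (T : CWExpr w) {V : Type} [Fintype V] (G : SimpleGraph V) (k : ℕ)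
    (hT : T.IsExprOf G) (hG : G.Connected) (hR : Room (wordBound w) (T.numNodes + k) W) :
    WP (wordBound w) (T.numNodes + k) W mcstProgram
      (128 * profNum w + (T.numNodes + 1) * stepTime w + 32)
      (fun τ => (MinCoverSpanningTree G k ∧ τ.reg ansR = 1) ∨
        (¬ MinCoverSpanningTree G k ∧ τ.reg ansR = 0))
      (State.init (mcstInput T k)) := by
  have h16 := hR.sixteen_le
  have hMY : wordBound w ≤ wordBound w * (T.numNodes + k) := Nat.le_mul_of_pos_right _ hR.one_le
  have hl := length_code T
  have hinp : (State.init (mcstInput T k)).arr inA = fun i => (mcstInput T k).getD i 0 := rfl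
  refine WP.time (WP.seq ((wp_setup hR (inp := fun i => (mcstInput T k).getD i 0) rfl
      (fun _ => rfl) hinp
    (fun a ha i => if_neg ha)).mono (fun τ hτ => ?_) le_rfl))
    (m := 128 * profNum w + (7 + (T.numNodes + 1) * stepTime w + 20)) (by omega)
  change Inv w (Function.update (fun i => (mcstInput T k).getD i 0)
    (3 * T.numNodes + 3) 4) 0 τ at hτ
  -- Past its end the input reads `0`, so both labels of the additional node are `0`.
  have hpast : ∀ i, 3 * T.numNodes + 3 < i →
      Function.update (fun i => (mcstInput T k).getD i 0) (3 * T.numNodes + 3) 4 i = 0 := by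
    intro i hi
    rw [Function.update_of_ne (by omega)]
    exact List.getD_eq_default _ _ (by simp [mcstInput, hl]; omega)
  have h1 : Function.update (fun i => (mcstInput T k).getD i 0) (3 * T.numNodes + 3) 4 1 = k :=
    Function.update_of_ne (by omega) _ _
  have h2 : Function.update (fun i => (mcstInput T k).getD i 0) (3 * T.numNodes + 3) 4 2 =
      T.numNodes :=
    Function.update_of_ne (by omega) _ _
  refine WP.seq ((wp_treeLoop hR (by rw [h2]; omega) T hτ h2 ?_ (Function.update_self ..)
    (hpast _ (by omega)) (hpast _ (by omega))).mono (fun ρ hρ => ?_) le_rfl)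
  · intro x hx
    rw [Function.update_of_ne (by omega)]
    simp only [mcstInput]
    rw [List.getD_append_right _ _ _ _ (by simp)]
    simp [hx]
  · obtain ⟨hρ, hacc⟩ := hρ
    have hc : ρ.arr tabA ((T.numNodes + 1) * stateNum w) = tabAt w ρ (T.numNodes + 1) 0 := rfl
    refine WP.time (WP.assign hR rfl ?_ ?_) (by decide)
    · have hite : ∀ (p : Prop) [Decidable p], (if p then 1 else 0) ≤ 1 := fun p _ => by
        split_ifs <;> simp
      exact (Nat.mul_le_mul (hite _) (hite _)).trans (h16.trans hMY |>.trans' (by norm_num))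
    · have := (minCoverSpanningTree_iff_comb T G k (slot 0) (slot 0) hT hG).trans (hacc k).symm
      rw [this, AtMost]
      simp only [State.reg_setReg, if_true, Expr.eval_mul, Expr.eval_lt, Expr.eval_get,
          Expr.eval_reg,
        Expr.eval_ofNat, Expr.eval_add, hρ.node, hρ.state, hρ.inp, h1, hc]
      split_ifs <;> omega

end

end RAM

/-! ### Bounds in the number of labels -/

theorem stateNum_pow_le {w : ℕ} (hw : 0 < w) {d : ℕ} (hd : d ≤ 512) :
    stateNum w ^ d ≤ 2 ^ 2 ^ (20 * w) := by
  rw [stateNum, ← pow_mul]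
  refine Nat.pow_le_pow_right (by norm_num) ?_
  calc profNum w * d ≤ 2 ^ (4 * w + 4) * 2 ^ 9 := Nat.mul_le_mul_left _ (by norm_num; exact hd)
    _ = 2 ^ (4 * w + 13) := by rw [← pow_add]
    _ ≤ _ := Nat.pow_le_pow_right (by norm_num) (by omega)

theorem time_le (w : ℕ) {N : ℕ} (hN : 1 ≤ N) :
    128 * profNum w + (N + 1) * RAM.stepTime w + 32 ≤ stateNum w ^ 8 * N := by
  have hP := (RAM.profNum_lt_stateNum w).le
  have hS : 2048 ≤ stateNum w := by
    have : 2 ^ 4 ≤ profNum w := Nat.pow_le_pow_right (by norm_num) (by omega)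
    calc 2048 = 2 ^ 11 := by norm_num
      _ ≤ _ := Nat.pow_le_pow_right (by norm_num) (by omega)
  generalize hs : stateNum w = S at *
  have h1 : RAM.stepTime w ≤ S ^ 6 := by
    rw [RAM.stepTime, RAM.tabTime, hs]
    have h5 : 2048 * (S * S) * (profNum w * profNum w) ≤ S ^ 5 :=
      calc _ ≤ S * (S * S) * (S * S) := by gcongr
        _ = S ^ 5 := by ring
    have h6 : 2048 * S ^ 5 ≤ S ^ 6 := by
      rw [pow_succ S 5, mul_comm]
      exact Nat.mul_le_mul_left _ hS
    have : 2048 ≤ S ^ 5 := hS.trans (Nat.le_self_pow (by norm_num) S)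
    omega
  have h7 : 2048 * S ^ 6 ≤ S ^ 8 :=
    calc 2048 * S ^ 6 ≤ (S * S) * S ^ 6 := Nat.mul_le_mul_right _ (by nlinarith)
      _ = S ^ 8 := by ring
  have h8 : S ≤ S ^ 6 := Nat.le_self_pow (by norm_num) S
  calc 128 * profNum w + (N + 1) * RAM.stepTime w + 32
      ≤ 128 * S ^ 6 + (N + N) * S ^ 6 + 32 * S ^ 6 := by
        have := Nat.mul_le_mul (show N + 1 ≤ N + N by omega) h1
        omega
    _ = 160 * S ^ 6 + 2 * S ^ 6 * N := by ring
    _ ≤ 160 * S ^ 6 * N + 2 * S ^ 6 * N := Nat.add_le_add_right (Nat.le_mul_of_pos_right _ hN) _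
    _ = (162 * S ^ 6) * N := by ring
    _ ≤ _ := Nat.mul_le_mul_right _ (by omega)

theorem mainTheorem5 :
    ∃ (p : RAM.Program) (c : ℕ),
      ∀ (w : ℕ) (T : CWExpr w) (V : Type) [Fintype V] (G : SimpleGraph V) (k : ℕ),
        T.IsExprOf G → G.Connected → 1 ≤ k →
          ∃ t : ℕ,
            RAM.Computes (2 ^ 2 ^ (c * w) * (T.numNodes + k)) p (mcstInput T k) t
              (MinCoverSpanningTree G k) ∧
            t ≤ 2 ^ 2 ^ (c * w) * T.numNodes ∧
            ∀ a : ℕ, T.numNodes ≤ a * Fintype.card V →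
              t ≤ a * 2 ^ 2 ^ (c * w) * Fintype.card V := by
  -- The word bound is `wordBound w ^ 128 = 2 ^ 2 ^ (4 * w + 13)` times the length of the input, and
  -- `4 * w + 13 ≤ 20 * w`.
  refine ⟨RAM.mcstProgram, 20, fun w T V _ G k hT hG _ => ?_⟩
  have hw := pos_of_expr T
  have hN : 1 ≤ T.numNodes := by cases T <;> simp [numNodes]
  have hR : RAM.Room (RAM.wordBound w) (T.numNodes + k) (2 ^ 2 ^ (20 * w) * (T.numNodes + k)) := by
    refine ⟨?_, by omega, Nat.mul_le_mul_right _ ?_⟩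
    · have := RAM.four_mul_stateNum_le w
      have := RAM.profNum_lt_stateNum w
      have : 4 * w + 4 < profNum w := Nat.lt_two_pow_self
      omega
    · rw [RAM.wordBound, ← pow_mul]
      exact stateNum_pow_le hw (by norm_num)
  obtain ⟨t, τ, ht, hexec, -, hans⟩ :=
    RAM.wp_mcstProgram T G k hT hG hR (RAM.bounded_init T k)
  have htN : t ≤ 2 ^ 2 ^ (20 * w) * T.numNodes :=
    (ht.trans (time_le w hN)).trans (Nat.mul_le_mul_right _ (stateNum_pow_le hw (by norm_num)))
  refine ⟨t, ⟨τ, hexec, hans⟩, htN, fun a ha => ?_⟩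
  calc t ≤ 2 ^ 2 ^ (20 * w) * T.numNodes := htN
    _ ≤ 2 ^ 2 ^ (20 * w) * (a * Fintype.card V) := Nat.mul_le_mul_left _ ha
    _ = a * 2 ^ 2 ^ (20 * w) * Fintype.card V := by ring
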